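/- **Problem.** Let $\mathcal Q(x)=c^Tx+\sum_{i=1}^N p_i\mathcal Q_i(x)$ on $\mathbb R^n$, where $p_i\ge 0$, $\sum_i p_i=1$ and $\mathcal Q_i(x)=\min\{q_i^Ty : Wy=h_i-T_ix,\ y\ge 0\}$. Assume that for every $i$ and every $x$ this second-stage linear program is feasible and has a finite value, and that the set $\mathcal S$ of minimizers of $\mathcal Q$ over $X=\{x: Ax=b,\ x\ge 0\}$ is nonempty. The scenarios are divided into clusters $\mathcal N_1,\dots,\mathcal N_T$, and $\mathcal Q_{[j]}=\sum_{i\in\mathcal N_j}p_i\mathcal Q_i$. **Models.** A *cut* for cluster $j$ is an affine function $x\mapsto g^Tx+f$. A finite set of cuts defines the model $m(x)=c^Tx+\sum_j m_{[j]}(x)$, where $m_{[j]}(x)$ is the maximum of the cuts for cluster $j$ at $x$ ($-\infty$ if there are none). The subproblem $\mathrm{trsub}(z,\Delta)$ is to minimize $m(x)$ over $x\in X$, $\|x-z\|_\infty\le\Delta$. **Algorithm ATR.** Parameters: $\xi\in(0,\frac12)$, $\eta\in[0,1)$, $\Delta_{\rm hi}>0$, $\sigma\in(0,1]$, an integer $K>0$,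 $\epsilon_{\rm tol}\ge 0$. Start with $x^0\in X$, incumbent index $I=-1$ (dummy; $x^{-1}=x^0$, $\mathcal Q^{-1}=\infty$), $I_0=-1$, $k=0$, $\Delta_{\rm curr}\in(0,\Delta_{\rm hi}]$, $\mathtt{counter}=0$, empty basket $\mathcal B$, a finite (possibly empty) initial set of cuts, each cut for cluster $j$ being $\le\mathcal Q_{[j]}$, and the $T$ tasks $(0,1),\dots,(0,T)$ issued. Task $(q,j)$ computes $\mathcal Q_{[j]}(x^q)$ and some $g_j\in\partial\mathcal Q_{[j]}(x^q)$. Issued tasks are completed in an arbitrary order, one at a time. For $I\ne-1$ write $\mathcal Q^I=\mathcal Q(x^I)$. When task $(q,j)$ is completed, the cut $x\mapsto\mathcal Q_{[j]}(x^q)+g_j^T(x-x^q)$, said to be generated at $q$, is added to the model. Then: 1. If all $T$ tasks of $x^q$ are now complete: if $\mathcal Q(x^q)<\mathcal Q^I$ and ($I_q=-1$ or $\mathcal Q(x^q)\le\mathcal Q^{I_q}-\xi(\mathcal Q^{I_q}-m^q)$), then set $I\leftarrow q$; if moreover $\mathcal Q(x^q)\le\mathcal Q^{I_q}-\frac12(\mathcal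 Q^{I_q}-m^q)$ and $\|x^q-x^{I_q}\|_\infty=\Delta_q$, set $\Delta_{\rm curr}\leftarrow\max(\Delta_{\rm curr},\min(\Delta_{\rm hi},2\Delta_q))$ (when $I_q=-1$ the first of these two conditions may be regarded as true or as false, and $\Delta_0$ is the initial radius); any cuts not generated at $q$ may be deleted. Otherwise, any cuts may be deleted except those generated at $I_k$, those active at the solution $x^k$ of its subproblem, and those generated at an $\ell$ with $I_\ell=I_k\ne-1$ and $\mathcal Q^{I_k}-m^k>\eta(\mathcal Q^{I_k}-m^\ell)$; and, if $I_q\neq-1$, with $\rho=\min(1,\Delta_q)\frac{\mathcal Q(x^q)-\mathcal Q^{I_q}}{\mathcal Q^{I_q}-m^q}$, increase $\mathtt{counter}$ by $1$ if $\rho>0$, and then, if $\rho>3$, or $\mathtt{counter}\ge3$ and $1<\rho\le3$, set $\Delta_{\rm curr}\leftarrow\min(\Delta_{\rm curr},\Delta_q/\min(\rho,4))$ and $\mathtt{counter}\leftarrow0$. In both cases remove $q$ from $\mathcal B$ and go to 3. 2. Otherwise, if at least $\sigma T$ tasks of $x^q$ are complete, $|\mathcal B|<K$, and $x^q$ has not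 yet triggered a new iterate in this step, go to 3. If not, wait for the next completed task. 3. Set $k\leftarrow k+1$, $\Delta_k=\Delta_{\rm curr}$, $I_k=I$; let $x^k$ be a solution of $\mathrm{trsub}(x^I,\Delta_k)$ with the current model and $m^k=m(x^k)$, which is assumed to be finite when $I\ne-1$. If $I\ne -1$ and $\mathcal Q^I-m^k\le\epsilon_{\rm tol}(1+|\mathcal Q^I|)$, STOP. Otherwise put $k$ into $\mathcal B$, issue the tasks $(k,1),\dots,(k,T)$, and wait for the next completed task. **Theorem.** Consider any run of Algorithm ATR with $\epsilon_{\rm tol}=0$ in which every issued task is completed after a finite time (that is, after finitely many task completions, unless the algorithm stops before). (i) If at some moment the incumbent satisfies $x^I\notin\mathcal S$, then this incumbent is replaced by a new incumbent after a finite time. (ii) If at some moment $I\ne-1$ and $x^I\in\mathcal S$, then either the algorithm terminates with this incumbent and verifies its optimality, the last model being an underestimate of $\mathcal Q$ that is $\ge\mathcal Q^I$ on $\{x\in X:\|x-x^I\|_\infty\le\Delta_k\}$ with $\Delta_k>0$; or infinitely many iterates are generated, from the current iterate on all of them have $I_k=I$, and $\mathcal Q^I-m^k$ decreases monotonically to $0$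 as $k\to\infty$. Whenever the algorithm terminates, its incumbent lies in $\mathcal S$. -/

import Mathlib

open scoped Matrix

namespace ATR

noncomputable section

/-! ### The two-stage stochastic linear program -/

/-- Data of a two-stage stochastic linear program with fixed recourse: `n` first-stage variables,
`m₁` first-stage constraints, `n₂` second-stage variables, `m₂` second-stage constraints, `N`
scenarios, grouped into `T` clusters. The norm of `Fin n → ℝ` is the `ℓ∞` norm. -/
structure TwoStageLP (n m₁ n₂ m₂ N T : ℕ) where
  A : Matrix (Fin m₁) (Fin n) ℝ
  b : Fin m₁ → ℝ
  c : Fin n → ℝ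
  /-- scenario probabilities -/
  p : Fin N → ℝ
  /-- second-stage costs `q(ω_i)` -/
  cost : Fin N → Fin n₂ → ℝ
  /-- recourse matrix -/
  W : Matrix (Fin m₂) (Fin n₂) ℝ
  /-- technology matrices `T(ω_i)` -/
  tech : Fin N → Matrix (Fin m₂) (Fin n) ℝ
  h : Fin N → Fin m₂ → ℝ
  /-- the cluster that contains scenario `i` -/
  cluster : Fin N → Fin T

variable {n m₁ n₂ m₂ N T : ℕ}

namespace TwoStageLP

variable (P : TwoStageLP n m₁ n₂ m₂ N T)

/-- First-stage feasible set `{x | A x = b, x ≥ 0}`. -/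
def feasible : Set (Fin n → ℝ) := {x | P.A *ᵥ x = P.b ∧ 0 ≤ x}

/-- Feasible set of the second-stage problem of scenario `i` at `x`. -/
def recourse (i : Fin N) (x : Fin n → ℝ) : Set (Fin n₂ → ℝ) :=
  {y | P.W *ᵥ y = P.h i - P.tech i *ᵥ x ∧ 0 ≤ y}

/-- Objective values of the second-stage problem of scenario `i` at `x`. -/
def recourseValues (i : Fin N) (x : Fin n → ℝ) : Set ℝ :=
  (fun y => P.cost i ⬝ᵥ y) '' P.recourse i x

/-- Optimal value `Q_i(x)` of the second-stage problem. -/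
def Qscen (i : Fin N) (x : Fin n → ℝ) : ℝ := sInf (P.recourseValues i x)

/-- Partial sum `Q_[j](x)` over the scenarios of cluster `j`. -/
def Qclus (j : Fin T) (x : Fin n → ℝ) : ℝ :=
  ∑ i ∈ Finset.univ.filter (fun i => P.cluster i = j), P.p i * P.Qscen i x

/-- The objective `Q(x) = cᵀx + ∑ p_i Q_i(x)`. -/
def Q (x : Fin n → ℝ) : ℝ := P.c ⬝ᵥ x + ∑ i, P.p i * P.Qscen i x

/-- The solution set `S` of `min Q(x)` subject to `A x = b`, `x ≥ 0`. -/
def solutionSet : Set (Fin n → ℝ) := {x | x ∈ P.feasible ∧ ∀ y ∈ P.feasible, P.Q x ≤ P.Q y}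

/-- Standing assumptions: the `p_i` are probabilities, the recourse is complete and all
second-stage optimal values are finite (so `Q` is finite on the whole space), and there is a
solution. -/
structure Standing : Prop where
  p_nonneg : ∀ i, 0 ≤ P.p i
  p_sum : ∑ i, P.p i = 1
  complete_recourse : ∀ i x, (P.recourse i x).Nonempty
  finite_value : ∀ i x, BddBelow (P.recourseValues i x)
  solvable : P.solutionSet.Nonempty

end TwoStageLP

/-! ### Cuts and models -/

/-- An optimality cut `θ_j ≥ gᵀx + f` for cluster `j`. The origin is the index of the iterate at
which the cut was generated, and `none` for a cut of the initial model. -/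
structure Cut (n T : ℕ) where
  origin : Option ℕ
  cluster : Fin T
  g : Fin n → ℝ
  f : ℝ

/-- Value `gᵀx + f` of the cut at `x`. -/
def Cut.val (C : Cut n T) (x : Fin n → ℝ) : ℝ := C.g ⬝ᵥ x + C.f

/-- `m_[j](x)`: the least `θ_j` that satisfies all the cuts for cluster `j`; it is `-∞` if there
are none. -/
def clusterModel (M : Set (Cut n T)) (j : Fin T) (x : Fin n → ℝ) : EReal :=
  ⨆ C ∈ {C ∈ M | C.cluster = j}, (C.val x : EReal)

/-- The model function `m(x) = cᵀx + ∑_j m_[j](x)` defined by the set of cuts `M`. -/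
def TwoStageLP.model (P : TwoStageLP n m₁ n₂ m₂ N T) (M : Set (Cut n T)) (x : Fin n → ℝ) :
    EReal :=
  ((P.c ⬝ᵥ x : ℝ) : EReal) + ∑ j, clusterModel M j x

/-- Feasible set of the trust-region subproblem with center `z` and radius `Δ`. -/
def TwoStageLP.trustRegion (P : TwoStageLP n m₁ n₂ m₂ N T) (z : Fin n → ℝ) (Δ : ℝ) :
    Set (Fin n → ℝ) :=
  {x | x ∈ P.feasible ∧ ‖x - z‖ ≤ Δ}

/-- `x` solves the subproblem `trsub(z, Δ)` for the model given by `M`. -/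
def TwoStageLP.SolvesTrsub (P : TwoStageLP n m₁ n₂ m₂ N T) (M : Set (Cut n T))
    (z : Fin n → ℝ) (Δ : ℝ) (x : Fin n → ℝ) : Prop :=
  x ∈ P.trustRegion z Δ ∧ ∀ y ∈ P.trustRegion z Δ, P.model M x ≤ P.model M y

/-- `g` is a subgradient of `F` at `z`. -/
def IsSubgradient (F : (Fin n → ℝ) → ℝ) (z g : Fin n → ℝ) : Prop :=
  ∀ x, F z + g ⬝ᵥ (x - z) ≤ F x

/-! ### Algorithm ATR -/

/-- Parameters of the algorithm. -/
structure Params where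
  /-- acceptance parameter -/
  ξ : ℝ
  /-- cut deletion parameter -/
  η : ℝ
  /-- upper bound on the trust-region radius -/
  Δhi : ℝ
  /-- synchronicity parameter -/
  σ : ℝ
  /-- maximum basket size -/
  K : ℕ
  /-- tolerance of the convergence test -/
  εtol : ℝ
  ξ_pos : 0 < ξ
  ξ_lt : ξ < 1 / 2
  η_nonneg : 0 ≤ η
  η_lt : η < 1
  Δhi_pos : 0 < Δhi
  σ_pos : 0 < σ
  σ_le : σ ≤ 1
  K_pos : 0 < K
  εtol_nonneg : 0 ≤ εtol

/-- The quantities that the algorithm attaches, once and for all, to the iterates. An entry is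
meaningful from the moment that the iterate has been generated (for `g q j`: the task `(q, j)`
has been completed). The parent incumbent index `none` stands for the dummy index `-1`. -/
structure History (n T : ℕ) where
  /-- iterates `x^k` -/
  x : ℕ → Fin n → ℝ
  /-- parent incumbents `I_k` -/
  parent : ℕ → Option ℕ
  /-- trust-region radii `Δ_k` -/
  Δ : ℕ → ℝ
  /-- optimal values `m^k` of the subproblems with a parent incumbent other than the dummy -/
  m : ℕ → ℝ
  /-- the set of cuts with which the subproblem for `x^k` was solved -/
  cuts : ℕ → Set (Cut n T)
  /-- partial subgradients `g_j` obtained at `x^q` -/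
  g : ℕ → Fin T → Fin n → ℝ

/-- The current values of the program variables. -/
structure State (n T : ℕ) where
  /-- index of the incumbent, `none` for the dummy index `-1` -/
  inc : Option ℕ
  /-- index of the latest iterate -/
  k : ℕ
  Δcurr : ℝ
  counter : ℕ
  basket : Finset ℕ
  /-- number of clusters evaluated so far at each iterate -/
  t : ℕ → ℕ
  speceval : ℕ → Bool
  /-- tasks `(q, j)` (evaluate cluster `j` at `x^q`) that have been issued and not completed -/
  pool : Set (ℕ × Fin T)
  /-- cuts of the current model -/
  model : Set (Cut n T)
  stopped : Bool

namespace History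

variable (H : History n T)

/-- The incumbent point `x^I`; the dummy point `x^{-1}` is `x^0`. -/
def point : Option ℕ → Fin n → ℝ
  | none => H.x 0
  | some r => H.x r

variable (P : TwoStageLP n m₁ n₂ m₂ N T) (par : Params)

/-- The cut generated by task `(q, j)`. -/
def cut (q : ℕ) (j : Fin T) : Cut n T :=
  ⟨some q, j, H.g q j, P.Qclus j (H.x q) - H.g q j ⬝ᵥ H.x q⟩

/-- The cut `C` was active at the solution `x^k` of its subproblem. -/
def Active (k : ℕ) (C : Cut n T) : Prop :=
  C ∈ H.cuts k ∧ (C.val (H.x k) : EReal) = clusterModel (H.cuts k) C.cluster (H.x k)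

/-- The cuts that Procedure Model-Update`(k)` must not delete. -/
def Protected (k : ℕ) (C : Cut n T) : Prop :=
  (∃ r, H.parent k = some r ∧ C.origin = some r) ∨
  H.Active k C ∨
  (∃ r l, H.parent k = some r ∧ C.origin = some l ∧ H.parent l = some r ∧
    P.Q (H.x r) - H.m k > par.η * (P.Q (H.x r) - H.m l))

/-- Procedure Model-Update`(k)` may turn the set of cuts `M` into `M'`. -/
def ModelUpdate (k : ℕ) (M M' : Set (Cut n T)) : Prop :=
  M' ⊆ M ∧ ∀ C ∈ M, H.Protected P par k C → C ∈ M'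

/-- The ratio `ρ` of Procedure Reduce-Δ`(q)`, where `r = I_q`. -/
def ρ (q r : ℕ) : ℝ :=
  min 1 (H.Δ q) * ((P.Q (H.x q) - P.Q (H.x r)) / (P.Q (H.x r) - H.m q))

open Classical in
/-- Procedure Reduce-Δ`(q)`, acting on the pair `(Δ_curr, counter)`. -/
def reduceΔ (q : ℕ) (Δcurr : ℝ) (counter : ℕ) : ℝ × ℕ :=
  match H.parent q with
  | none => (Δcurr, counter)
  | some r =>
    let ρ := H.ρ P q r
    let counter' := if 0 < ρ then counter + 1 else counter
    if 3 < ρ ∨ (3 ≤ counter' ∧ 1 < ρ ∧ ρ ≤ 3) then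
      (min Δcurr (H.Δ q / min ρ 4), 0)
    else (Δcurr, counter')

/-- The update `Δ → Δ'` of the radius when `x^q` becomes the incumbent. If `I_q = -1`, the test
compares infinite quantities, and both outcomes of its first part are allowed. -/
def IncreaseΔ (q : ℕ) (Δ Δ' : ℝ) : Prop :=
  match H.parent q with
  | none => Δ' = Δ ∨ (‖H.x q - H.x 0‖ = H.Δ q ∧ Δ' = max Δ (min par.Δhi (2 * H.Δ q)))
  | some r =>
    let test := P.Q (H.x q) ≤ P.Q (H.x r) - 0.5 * (P.Q (H.x r) - H.m q) ∧
      ‖H.x q - H.x r‖ = H.Δ q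
    (test → Δ' = max Δ (min par.Δhi (2 * H.Δ q))) ∧ (¬ test → Δ' = Δ)

/-- The test for `x^q` to replace the incumbent with index `inc`. -/
def Accept (inc : Option ℕ) (q : ℕ) : Prop :=
  (∀ r, inc = some r → P.Q (H.x q) < P.Q (H.x r)) ∧
  (∀ r, H.parent q = some r →
    P.Q (H.x q) ≤ P.Q (H.x r) - par.ξ * (P.Q (H.x r) - H.m q))

/-- The convergence test for the latest iterate `x^k`; it fails for the dummy incumbent, whose
value is `∞`. -/
def ConvTest (inc : Option ℕ) (k : ℕ) : Prop :=
  ∃ r, inc = some r ∧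
    P.Q (H.x r) - H.m k ≤ par.εtol * (1 + |P.Q (H.x r)|)

/-- First part of `act_on_completed_task` for the task `(q, j)`: count it and add its cut. -/
def record (q : ℕ) (j : Fin T) (s : State n T) : State n T :=
  { s with
    t := Function.update s.t q (s.t q + 1)
    model := insert (H.cut P q j) s.model
    pool := s.pool \ {(q, j)} }

/-- The evaluation at `x^q` has proceeded far enough to trigger a basket-filling iterate. -/
def FillTest (q : ℕ) (s : State n T) : Prop :=
  s.t q ≠ T ∧ par.σ * T ≤ s.t q ∧ s.basket.card < par.K ∧ s.speceval q = false

/-- Middle part of `act_on_completed_task`, in the cases in which it leads to a new iterate. -/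
inductive Trigger (q : ℕ) (s : State n T) : State n T → Prop
  | accept (M' : Set (Cut n T)) (Δ' : ℝ) (full : s.t q = T)
      (acc : H.Accept P par s.inc q)
      (radius : H.IncreaseΔ P par q s.Δcurr Δ')
      (sub : M' ⊆ s.model)
      (keep : ∀ C ∈ s.model, C.origin = some q → C ∈ M') :
      Trigger q s
        { s with inc := some q, Δcurr := Δ', model := M', basket := s.basket.erase q }
  | reject (M' : Set (Cut n T)) (full : s.t q = T)
      (rej : ¬ H.Accept P par s.inc q)
      (upd : H.ModelUpdate P par s.k s.model M') :
      Trigger q s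
        { s with
          model := M'
          Δcurr := (H.reduceΔ P q s.Δcurr s.counter).1
          counter := (H.reduceΔ P q s.Δcurr s.counter).2
          basket := s.basket.erase q }
  | fill (test : FillTest par q s) :
      Trigger q s { s with speceval := Function.update s.speceval q true }

/-- Last part of `act_on_completed_task`: generate the next iterate, then stop, or put the point
into the basket and issue its tasks. The subproblem has to have a finite optimal value, except
during the startup phase, when some cluster may be without any cut. -/
structure NewIterate (s s' : State n T) : Prop where
  parent_eq : H.parent (s.k + 1) = s.inc
  Δ_eq : H.Δ (s.k + 1) = s.Δcurr
  cuts_eq : H.cuts (s.k + 1) = s.model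
  solves : P.SolvesTrsub s.model (H.point s.inc) s.Δcurr (H.x (s.k + 1))
  m_eq : s.inc ≠ none → (H.m (s.k + 1) : EReal) = P.model s.model (H.x (s.k + 1))
  halts : H.ConvTest P par s.inc (s.k + 1) → s' = { s with k := s.k + 1, stopped := true }
  go_on : ¬ H.ConvTest P par s.inc (s.k + 1) → s' =
    { s with
      k := s.k + 1
      basket := insert (s.k + 1) s.basket
      speceval := Function.update s.speceval (s.k + 1) false
      t := Function.update s.t (s.k + 1) 0
      pool := s.pool ∪ {τ | τ.1 = s.k + 1} }

/-- `act_on_completed_task` for the task `(q, j)` may lead from state `s` to state `s'`. -/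
inductive Act (q : ℕ) (j : Fin T) (s : State n T) : State n T → Prop
  | generate (s₂ s' : State n T) (trig : H.Trigger P par q (H.record P q j s) s₂)
      (new : H.NewIterate P par s₂ s') : Act q j s s'
  | idle (not_full : (H.record P q j s).t q ≠ T)
      (not_fill : ¬ FillTest par q (H.record P q j s)) : Act q j s (H.record P q j s)

/-- The state after the initialization at a feasible starting point. The initial model is any
finite (possibly empty) set of cuts that underestimate the partial sums. -/
structure Init (s : State n T) : Prop where
  start : H.x 0 ∈ P.feasible
  parent_zero : H.parent 0 = none
  Δ_zero : H.Δ 0 = s.Δcurr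
  inc : s.inc = none
  k : s.k = 0
  Δ_pos : 0 < s.Δcurr
  Δ_le : s.Δcurr ≤ par.Δhi
  counter : s.counter = 0
  basket : s.basket = ∅
  t : s.t = fun _ => 0
  speceval : s.speceval = fun _ => false
  pool : s.pool = {τ | τ.1 = 0}
  model_finite : s.model.Finite
  model_origin : ∀ C ∈ s.model, C.origin = none
  model_under : ∀ C ∈ s.model, ∀ x, C.val x ≤ P.Qclus C.cluster x
  stopped : s.stopped = false

/-- A run of Algorithm ATR: `s i` is the state after `i` calls of `act_on_completed_task`. The
tasks may be completed in any order, each with any subgradient; after STOP nothing changes. -/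
structure IsRun (s : ℕ → State n T) : Prop where
  init : H.Init P par (s 0)
  step : ∀ i, (s i).stopped = false → ∃ q j, (q, j) ∈ (s i).pool ∧
    IsSubgradient (P.Qclus j) (H.x q) (H.g q j) ∧ H.Act P par q j (s i) (s (i + 1))
  halt : ∀ i, (s i).stopped = true → s (i + 1) = s i

end History

/-- Every task is completed after a finite time (unless the algorithm stops before). -/
def TasksComplete (s : ℕ → State n T) : Prop :=
  ∀ i, ∀ τ ∈ (s i).pool, ∃ i' ≥ i, (s i').stopped = true ∨ τ ∉ (s i').pool

end

end ATR

namespace ATR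

variable {n m₁ n₂ m₂ N T : ℕ}

/-! ### Convexity of the recourse functions -/

namespace TwoStageLP

variable {P : TwoStageLP n m₁ n₂ m₂ N T}

/-! While an incumbent `x^r` stays fixed, the trust region can only shrink about its center, and the
cuts active at the last subproblem solution survive. By convexity these cuts alone determine the
optimal value (`SolvesTrsub.le_model_of_active`), so the gap `Q(x^r) - m^k` is nonincreasing. It is
positive, because with zero tolerance a nonpositive gap stops the algorithm.

The gap tends to zero (`QuietRun.gap_tendsto_zero`). If its limit `γ` were positive, the gaps would
eventually be nearly equal, and `η < 1` would protect every cut generated from then on. An evaluated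
iterate `x^l` has failed the acceptance test, so `Q(x^l)` exceeds `Q(x^r) - γ` by a fixed amount,
and its cuts keep later models above `Q(x^r) - γ` near `x^l`. By compactness a later iterate falls
near such an `x^l`, and its gap is below `γ`: a contradiction.

If `x^r` is not optimal, convexity yields a decrease of at least `min 1 Δ * κ` within radius `Δ`
(`Standing.exists_decrease`). Since the model minorizes `Q`, this bounds the gap below. Reducing the
radius requires `ρ > 1`, which then forces `Q(x^q) - Q(x^r) > κ`; continuity rules this out for
small `Δ_q`. So radius and gap stay away from zero, contradicting the previous paragraph: an
incumbent kept forever is optimal.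

If the algorithm stops, its model squeezes `Q` from below on a trust region of positive radius, and
local optimality is global. An optimal incumbent is never replaced, since acceptance demands strict
decrease. -/

theorem Standing.T_pos (hP : P.Standing) : 0 < T := by
  rcases Nat.eq_zero_or_pos N with rfl | hN
  · simpa using hP.p_sum
  · exact lt_of_le_of_lt (Nat.zero_le _) (P.cluster ⟨0, hN⟩).isLt

/-- A convex combination of recourse decisions is feasible at the combined point. Working with
`ε`-optimal decisions avoids attainment of the infimum. -/
theorem Standing.convexOn_Qscen (hP : P.Standing) (i : Fin N) :
    ConvexOn ℝ Set.univ (P.Qscen i) := by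
  refine ⟨convex_univ, fun x _ y _ a b ha hb hab => ?_⟩
  have hne : ∀ x, (P.recourseValues i x).Nonempty := fun x =>
    (hP.complete_recourse i x).image _
  refine le_of_forall_pos_lt_add fun ε hε => ?_
  obtain ⟨_, ⟨u, hu, rfl⟩, hu'⟩ := exists_lt_of_csInf_lt (hne x)
    (lt_add_of_pos_right (sInf (P.recourseValues i x)) hε)
  obtain ⟨_, ⟨v, hv, rfl⟩, hv'⟩ := exists_lt_of_csInf_lt (hne y)
    (lt_add_of_pos_right (sInf (P.recourseValues i y)) hε)
  have hmem : a • u + b • v ∈ P.recourse i (a • x + b • y) := by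
    refine ⟨?_, add_nonneg (smul_nonneg ha hu.2) (smul_nonneg hb hv.2)⟩
    rw [Matrix.mulVec_add, Matrix.mulVec_smul, Matrix.mulVec_smul, hu.1, hv.1,
      Matrix.mulVec_add, Matrix.mulVec_smul, Matrix.mulVec_smul]
    have : P.h i = a • P.h i + b • P.h i := by rw [← add_smul, hab, one_smul]
    conv_rhs => rw [this]
    simp only [smul_sub]
    abel
  have hle := csInf_le (hP.finite_value i (a • x + b • y)) ⟨_, hmem, rfl⟩
  simp only [dotProduct_add, dotProduct_smul, smul_eq_mul] at hle
  change sInf _ < a * sInf _ + b * sInf _ + ε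
  dsimp only at hu' hv'
  rcases ha.eq_or_lt with rfl | ha
  · obtain rfl : b = 1 := by linarith
    linarith
  · nlinarith

theorem Standing.convexOn_Q (hP : P.Standing) : ConvexOn ℝ Set.univ P.Q := by
  refine ⟨convex_univ, fun x _ y _ a b ha hb hab => ?_⟩
  have hsum : ∑ i, P.p i * P.Qscen i (a • x + b • y) ≤
      ∑ i, (a * (P.p i * P.Qscen i x) + b * (P.p i * P.Qscen i y)) := by
    refine Finset.sum_le_sum fun i _ => ?_
    have := mul_le_mul_of_nonneg_left
      ((hP.convexOn_Qscen i).2 (Set.mem_univ x) (Set.mem_univ y) ha hb hab) (hP.p_nonneg i)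
    simp only [smul_eq_mul] at this
    linarith
  rw [Finset.sum_add_distrib, ← Finset.mul_sum, ← Finset.mul_sum] at hsum
  simp only [Q, dotProduct_add, dotProduct_smul, smul_eq_mul]
  linarith

theorem Standing.continuous_Q (hP : P.Standing) : Continuous P.Q :=
  hP.convexOn_Q.locallyLipschitz.continuous

theorem Q_eq_sum_Qclus (x : Fin n → ℝ) : P.Q x = P.c ⬝ᵥ x + ∑ j, P.Qclus j x := by
  simp only [Q, Qclus, Finset.sum_fiberwise]

theorem convex_trustRegion (z : Fin n → ℝ) (Δ : ℝ) : Convex ℝ (P.trustRegion z Δ) := by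
  have hball : Convex ℝ {x : Fin n → ℝ | ‖x - z‖ ≤ Δ} := by
    simpa [Metric.closedBall, dist_eq_norm] using convex_closedBall z Δ
  refine Convex.inter (s := P.feasible) ?_ hball
  intro x hx y hy a b ha hb hab
  refine ⟨?_, add_nonneg (smul_nonneg ha hx.2) (smul_nonneg hb hy.2)⟩
  rw [Matrix.mulVec_add, Matrix.mulVec_smul, Matrix.mulVec_smul, hx.1, hy.1, ← add_smul, hab,
    one_smul]

theorem center_mem_trustRegion {z : Fin n → ℝ} (hz : z ∈ P.feasible) {Δ : ℝ} (hΔ : 0 ≤ Δ) :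
    z ∈ P.trustRegion z Δ := ⟨hz, by simpa using hΔ⟩

/-- From a feasible point that is not optimal, the objective can be decreased at a positive rate
within any trust region. -/
theorem Standing.exists_decrease (hP : P.Standing) {z : Fin n → ℝ} (hz : z ∈ P.feasible)
    (hzS : z ∉ P.solutionSet) :
    ∃ κ > 0, ∀ Δ > 0, ∃ x ∈ P.trustRegion z Δ, P.Q x ≤ P.Q z - min 1 Δ * κ := by
  obtain ⟨w, hw, hopt⟩ := hP.solvable
  have hlt : P.Q w < P.Q z := by
    by_contra! h
    exact hzS ⟨hz, fun y hy => h.trans (hopt y hy)⟩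
  have hd : 0 < 1 + ‖w - z‖ := by positivity
  refine ⟨(P.Q z - P.Q w) / (1 + ‖w - z‖), div_pos (sub_pos.2 hlt) hd, fun Δ hΔ => ?_⟩
  have hmin : 0 < min 1 Δ := lt_min one_pos hΔ
  -- A step of relative length `t` towards a minimizer `w`: the summand `1` ensures `t ≤ 1`, and the
  -- step has length `t * ‖w - z‖ ≤ Δ`.
  set t := min 1 Δ / (1 + ‖w - z‖) with ht
  have ht0 : 0 < t := div_pos hmin hd
  have htd : t * (1 + ‖w - z‖) = min 1 Δ := div_mul_cancel₀ _ hd.ne'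
  have hn := norm_nonneg (w - z)
  have ht1 : t ≤ 1 := by nlinarith [min_le_left 1 Δ]
  have hmem := convex_trustRegion (P := P) z ‖w - z‖ (center_mem_trustRegion hz hn)
    (⟨hw, le_rfl⟩ : w ∈ P.trustRegion z ‖w - z‖) (sub_nonneg.2 ht1) ht0.le (by ring)
  refine ⟨(1 - t) • z + t • w, ⟨hmem.1, ?_⟩, ?_⟩
  · have : (1 - t) • z + t • w - z = t • (w - z) := by module
    rw [this, norm_smul, Real.norm_of_nonneg ht0.le]
    nlinarith [min_le_right 1 Δ]
  · have := hP.convexOn_Q.2 (Set.mem_univ z) (Set.mem_univ w) (sub_nonneg.2 ht1) ht0.le (by ring)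
    simp only [smul_eq_mul] at this
    have e : min 1 Δ * ((P.Q z - P.Q w) / (1 + ‖w - z‖)) = t * (P.Q z - P.Q w) := by
      rw [ht]; ring
    rw [e]
    linarith

/-! ### Values of the model -/

theorem coe_add_sum (a : ℝ) (v : Fin T → ℝ) :
    ((a + ∑ j, v j : ℝ) : EReal) = (a : EReal) + ∑ j, (v j : EReal) := by
  have : ∀ S : Finset (Fin T), ((∑ j ∈ S, v j : ℝ) : EReal) = ∑ j ∈ S, (v j : EReal) := by
    intro S
    induction S using Finset.induction_on with
    | empty => simp
    | insert j S hj ih => rw [Finset.sum_insert hj, Finset.sum_insert hj, EReal.coe_add, ih]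
  rw [EReal.coe_add, this]

theorem val_le_clusterModel {M : Set (Cut n T)} {C : Cut n T} (hC : C ∈ M) (x : Fin n → ℝ) :
    (C.val x : EReal) ≤ clusterModel M C.cluster x :=
  le_iSup₂_of_le (f := fun C (_ : C ∈ {D ∈ M | D.cluster = _}) => (Cut.val C x : EReal))
    C ⟨hC, rfl⟩ le_rfl

theorem le_model {M : Set (Cut n T)} {x : Fin n → ℝ} {v : Fin T → ℝ}
    (h : ∀ j, ∃ C ∈ M, C.cluster = j ∧ v j ≤ C.val x) :
    ((P.c ⬝ᵥ x + ∑ j, v j : ℝ) : EReal) ≤ P.model M x := by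
  rw [coe_add_sum]
  refine add_le_add le_rfl (Finset.sum_le_sum fun j _ => ?_)
  obtain ⟨C, hC, rfl, hv⟩ := h j
  exact (EReal.coe_le_coe_iff.2 hv).trans (val_le_clusterModel hC x)

theorem model_le {M : Set (Cut n T)} {x : Fin n → ℝ} {v : Fin T → ℝ}
    (h : ∀ C ∈ M, C.val x ≤ v C.cluster) :
    P.model M x ≤ ((P.c ⬝ᵥ x + ∑ j, v j : ℝ) : EReal) := by
  rw [coe_add_sum]
  refine add_le_add le_rfl (Finset.sum_le_sum fun j _ => iSup₂_le ?_)
  rintro C ⟨hC, rfl⟩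
  exact EReal.coe_le_coe_iff.2 (h C hC)

theorem model_le_Q {M : Set (Cut n T)} (h : ∀ C ∈ M, ∀ x, C.val x ≤ P.Qclus C.cluster x)
    (x : Fin n → ℝ) : P.model M x ≤ (P.Q x : EReal) := by
  rw [Q_eq_sum_Qclus]
  exact model_le fun C hC => h C hC x

/-- Where the model is finite, every cluster has an active cut. -/
theorem exists_active {M : Set (Cut n T)} (hM : M.Finite) {x : Fin n → ℝ} {m : ℝ}
    (hm : (m : EReal) = P.model M x) :
    ∃ A : Fin T → Cut n T, (∀ j, A j ∈ M ∧ (A j).cluster = j) ∧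
      (∀ C ∈ M, C.val x ≤ (A C.cluster).val x) ∧ m = P.c ⬝ᵥ x + ∑ j, (A j).val x := by
  have hne : ∀ j, ({C ∈ M | C.cluster = j} : Set (Cut n T)).Nonempty := by
    intro j
    by_contra h
    rw [Set.not_nonempty_iff_eq_empty] at h
    have hbot : clusterModel M j x = ⊥ := by simp [clusterModel, h]
    have : P.model M x = ⊥ := by
      rw [model, ← Finset.add_sum_erase _ _ (Finset.mem_univ j), hbot]
      simp
    rw [this] at hm
    exact EReal.coe_ne_bot m hm
  choose A hA hmax using fun j => Set.exists_max_image _ (fun C : Cut n T => C.val x)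
    (hM.subset (Set.sep_subset M fun C => C.cluster = j)) (hne j)
  refine ⟨A, hA, fun C hC => hmax _ C ⟨hC, rfl⟩, ?_⟩
  rw [← EReal.coe_eq_coe_iff, hm]
  exact le_antisymm (model_le fun C hC => hmax _ C ⟨hC, rfl⟩)
    (le_model fun j => ⟨A j, (hA j).1, (hA j).2, le_rfl⟩)

/-- The cuts active at a solution of the subproblem determine its optimal value. -/
theorem SolvesTrsub.le_model_of_active {M M' : Set (Cut n T)} {z x : Fin n → ℝ} {Δ m : ℝ}
    (hsol : P.SolvesTrsub M z Δ x) (hM : M.Finite) (hm : (m : EReal) = P.model M x)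
    (hact : ∀ C ∈ M, (C.val x : EReal) = clusterModel M C.cluster x → C ∈ M')
    {y : Fin n → ℝ} (hy : y ∈ P.trustRegion z Δ) : (m : EReal) ≤ P.model M' y := by
  obtain ⟨A, hA, hAmax, hAm⟩ := exists_active hM hm
  have hmodel : ∀ j, clusterModel M j x = ((A j).val x : EReal) := fun j =>
    le_antisymm (iSup₂_le fun C hC => EReal.coe_le_coe_iff.2 (hC.2 ▸ hAmax C hC.1))
      ((congrArg (fun i => clusterModel M i x) (hA j).2) ▸ val_le_clusterModel (hA j).1 x)
  -- `B j` is the largest at `y` among the cuts of cluster `j` active at `x`.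
  choose B hB hBmax using fun j => Set.exists_max_image
    {C ∈ M | C.cluster = j ∧ C.val x = (A j).val x} (fun C : Cut n T => C.val y)
    (hM.subset (Set.sep_subset _ _)) ⟨A j, (hA j).1, (hA j).2, rfl⟩
  have hval : ∀ (C : Cut n T) (t : ℝ),
      C.val (x + t • (y - x)) = C.val x + t * (C.val y - C.val x) := by
    intro C t
    simp only [Cut.val, dotProduct_add, dotProduct_smul, dotProduct_sub, smul_eq_mul]
    ring
  suffices h : m ≤ P.c ⬝ᵥ y + ∑ j, (B j).val y by
    refine (EReal.coe_le_coe_iff.2 h).trans (le_model fun j => ⟨B j, hact _ (hB j).1 ?_,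
      (hB j).2.1, le_rfl⟩)
    rw [(hB j).2.1, hmodel, (hB j).2.2]
  by_contra! hlt
  -- Near `x` on the segment to `y`, inactive cuts stay below by continuity, and active ones grow no
  -- faster than `B`. If the active cuts gave less than `m` at `y`, the full model would drop below
  -- its minimum `m`.
  have hev : ∀ᶠ t : ℝ in nhdsWithin 0 (Set.Ioi 0), ∀ C ∈ M, C.val (x + t • (y - x)) ≤
      (A C.cluster).val x + t * ((B C.cluster).val y - (A C.cluster).val x) := by
    rw [Filter.eventually_all_finite hM]
    intro C hC
    simp only [hval]
    rcases (hAmax C hC).eq_or_lt with he | hl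
    · filter_upwards [self_mem_nhdsWithin] with t ht
      have := hBmax C.cluster C ⟨hC, rfl, he⟩
      rw [he]
      have h0 : (0 : ℝ) ≤ t := (Set.mem_Ioi.1 ht).le
      gcongr
    · refine Filter.Eventually.filter_mono nhdsWithin_le_nhds ?_
      have hc : ∀ a b : ℝ, Filter.Tendsto (fun t : ℝ => a + t * b) (nhds 0) (nhds a) := by
        intro a b
        have : Continuous fun t : ℝ => a + t * b := by fun_prop
        simpa using this.tendsto 0
      exact ((hc _ _).eventually_lt (hc _ _) hl).mono fun _ h => h.le
  obtain ⟨t, ht, ht1, ht0⟩ := (hev.and ((Filter.Eventually.filter_mono nhdsWithin_le_nhds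
    (Iic_mem_nhds one_pos)).and self_mem_nhdsWithin)).exists
  replace ht0 : 0 < t := ht0
  have hmem : x + t • (y - x) ∈ P.trustRegion z Δ := by
    have e : x + t • (y - x) = (1 - t) • x + t • y := by module
    rw [e]
    exact convex_trustRegion z Δ hsol.1 hy (sub_nonneg.2 ht1) ht0.le (by ring)
  have hle := (hsol.2 _ hmem).trans (model_le
    (v := fun j => (A j).val x + t * ((B j).val y - (A j).val x)) ht)
  rw [← hm, EReal.coe_le_coe_iff, Finset.sum_add_distrib, ← Finset.mul_sum,
    Finset.sum_sub_distrib, dotProduct_add, dotProduct_smul, dotProduct_sub, smul_eq_mul] at hle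
  nlinarith

/-- The cuts of all the clusters generated at `z` bound the model from below, up to a multiple of
the distance to `z`. -/
theorem le_model_of_subgradients {M : Set (Cut n T)} {z : Fin n → ℝ} {g : Fin T → Fin n → ℝ}
    (hg : ∀ j, IsSubgradient (P.Qclus j) z (g j))
    (hM : ∀ j, ∃ C ∈ M, C.cluster = j ∧
      ∀ x, C.val x = P.Qclus j z + g j ⬝ᵥ (x - z))
    {D : ℝ} (hD : ∀ u : Fin n → ℝ, ‖u‖ ≤ 1 → P.Q (z + u) - P.Q z ≤ D) (x : Fin n → ℝ) :
    ((P.Q z - D * ‖x - z‖ : ℝ) : EReal) ≤ P.model M x := by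
  have hlow : ((P.c ⬝ᵥ x + ∑ j, (P.Qclus j z + g j ⬝ᵥ (x - z)) : ℝ) : EReal) ≤ P.model M x :=
    le_model fun j => by
      obtain ⟨C, hC, hj, hv⟩ := hM j
      exact ⟨C, hC, hj, (hv x).ge⟩
  refine le_trans (EReal.coe_le_coe_iff.2 ?_) hlow
  have hsub : ∀ u, P.c ⬝ᵥ u + ∑ j, g j ⬝ᵥ u ≤ P.Q (z + u) - P.Q z := by
    intro u
    have := Finset.sum_le_sum fun j (_ : j ∈ Finset.univ) => hg j (z + u)
    simp only [add_sub_cancel_left, Finset.sum_add_distrib] at this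
    rw [Q_eq_sum_Qclus, Q_eq_sum_Qclus, dotProduct_add]
    linarith
  rw [Finset.sum_add_distrib, Q_eq_sum_Qclus]
  have hcx : P.c ⬝ᵥ x = P.c ⬝ᵥ z + P.c ⬝ᵥ (x - z) := by rw [dotProduct_sub]; ring
  rw [hcx]
  rcases eq_or_ne (x - z) 0 with h0 | h0
  · simp [h0]
  have hpos : 0 < ‖x - z‖ := norm_pos_iff.2 h0
  -- Testing the aggregated subgradient on the unit vector opposite to `x - z` bounds its slope
  -- below by `-D`, without any bound on the individual `g j`.
  have h1 := (hsub (-(‖x - z‖⁻¹ • (x - z)))).trans (hD _ (by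
    rw [norm_neg, norm_smul, norm_inv, norm_norm, inv_mul_cancel₀ hpos.ne']))
  simp only [dotProduct_neg, dotProduct_smul, smul_eq_mul, Finset.sum_neg_distrib,
    ← Finset.mul_sum] at h1
  have h2 : ‖x - z‖ * (-(‖x - z‖⁻¹ * P.c ⬝ᵥ (x - z)) + -(‖x - z‖⁻¹ * ∑ j, g j ⬝ᵥ (x - z))) =
      -(P.c ⬝ᵥ (x - z) + ∑ j, g j ⬝ᵥ (x - z)) := by
    field_simp
    ring
  have h3 := mul_le_mul_of_nonneg_left h1 hpos.le
  rw [h2] at h3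
  linarith

end TwoStageLP

/-! ### Invariants of the algorithm -/

namespace History

variable (H : History n T) (P : TwoStageLP n m₁ n₂ m₂ N T) (par : Params)

/-- The properties of an iterate `x^q` with parent incumbent `r`. -/
structure IterateSpec (q r : ℕ) : Prop where
  finite : (H.cuts q).Finite
  under : ∀ C ∈ H.cuts q, ∀ x, C.val x ≤ P.Qclus C.cluster x
  solves : P.SolvesTrsub (H.cuts q) (H.x r) (H.Δ q) (H.x q)
  m_eq : (H.m q : EReal) = P.model (H.cuts q) (H.x q)

/-- The part of the invariant that holds throughout `act_on_completed_task`. -/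
structure CoreInvariant (s : State n T) : Prop where
  Δcurr_pos : 0 < s.Δcurr
  model_finite : s.model.Finite
  model_under : ∀ C ∈ s.model, ∀ x, C.val x ≤ P.Qclus C.cluster x
  inc_le : ∀ r, s.inc = some r → r ≤ s.k
  Δ_pos : ∀ q ≤ s.k, 0 < H.Δ q
  feas : ∀ q ≤ s.k, H.x q ∈ P.feasible
  pool_le : ∀ τ ∈ s.pool, τ.1 ≤ s.k
  count : s.stopped = false → ∀ q ≤ s.k, s.t q + {j | (q, j) ∈ s.pool}.ncard = T
  subgrad : s.stopped = false → ∀ q ≤ s.k, ∀ j, (q, j) ∉ s.pool →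
    IsSubgradient (P.Qclus j) (H.x q) (H.g q j)
  iter : ∀ q ≤ s.k, ∀ r, H.parent q = some r → r ≤ s.k ∧ H.IterateSpec P q r
  gap_pos : par.εtol = 0 → s.stopped = false → ∀ q ≤ s.k, ∀ r, H.parent q = some r →
    0 < P.Q (H.x r) - H.m q
  conv : s.stopped = true → H.ConvTest P par s.inc s.k
  no_parent : s.inc = none → ∀ q ≤ s.k, H.parent q = none

/-- The invariant that holds whenever the algorithm waits for a task or has stopped. -/
structure Invariant (s : State n T) : Prop extends CoreInvariant H P par s where
  parent_k : H.parent s.k = s.inc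
  Δ_k : H.Δ s.k = s.Δcurr
  cuts_sub : s.inc ≠ none → H.cuts s.k ⊆ s.model
  latest : s.stopped = false → ∃ j, (s.k, j) ∈ s.pool
  startup : s.stopped = false → s.inc = none → ∃ j, (0, j) ∈ s.pool

variable {H P par} {s s' : State n T} {q : ℕ} {j : Fin T}

theorem IterateSpec.m_le_Q {r : ℕ} (h : H.IterateSpec P q r) {x : Fin n → ℝ}
    (hx : x ∈ P.trustRegion (H.x r) (H.Δ q)) : H.m q ≤ P.Q x := by
  rw [← EReal.coe_le_coe_iff, h.m_eq]
  exact (h.solves.2 x hx).trans (TwoStageLP.model_le_Q h.under x)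

theorem cut_val (q : ℕ) (j : Fin T) (x : Fin n → ℝ) :
    (H.cut P q j).val x = P.Qclus j (H.x q) + H.g q j ⬝ᵥ (x - H.x q) := by
  simp only [cut, Cut.val, dotProduct_sub]
  ring

/-- The evaluation count and the number of open tasks of an iterate add up to `T`. -/
theorem CoreInvariant.full_iff (h : H.CoreInvariant P par s) (hs : s.stopped = false)
    (hq : q ≤ s.k) : s.t q = T ↔ ∀ j, (q, j) ∉ s.pool := by
  have hc := h.count hs q hq
  constructor
  · intro ht j hj
    have h0 : {j | (q, j) ∈ s.pool}.ncard = 0 := by omega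
    rw [Set.ncard_eq_zero] at h0
    exact (h0 ▸ (show j ∈ {j | (q, j) ∈ s.pool} from hj) : j ∈ (∅ : Set (Fin T)))
  · intro hj
    have h0 : {j | (q, j) ∈ s.pool} = ∅ := Set.eq_empty_of_forall_notMem hj
    rw [h0, Set.ncard_empty] at hc
    exact hc

/-! ### Preservation of the invariant -/

theorem CoreInvariant.record (h : H.CoreInvariant P par s) (hs : s.stopped = false)
    (hqj : (q, j) ∈ s.pool) (hg : IsSubgradient (P.Qclus j) (H.x q) (H.g q j)) :
    H.CoreInvariant P par (H.record P q j s) where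
  Δcurr_pos := h.Δcurr_pos
  model_finite := h.model_finite.insert _
  model_under := by
    rintro C (rfl | hC) x
    · rw [cut_val]
      exact hg x
    · exact h.model_under C hC x
  inc_le := h.inc_le
  Δ_pos := h.Δ_pos
  feas := h.feas
  pool_le := fun τ hτ => h.pool_le τ hτ.1
  count := by
    intro _ q' hq'
    have hc := h.count hs q' hq'
    simp only [History.record]
    rcases eq_or_ne q' q with rfl | hne
    · rw [Function.update_self]
      refine Eq.trans ?_ hc
      have e : {j' | (q', j') ∈ s.pool \ {(q', j)}} = {j' | (q', j') ∈ s.pool} \ {j} := by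
        ext j'
        simp
      rw [e, add_assoc, add_comm 1, Set.ncard_sdiff_singleton_add_one]
      exact hqj
    · rw [Function.update_of_ne hne]
      refine Eq.trans ?_ hc
      congr 2
      ext j'
      simp [hne]
  subgrad := by
    intro _ q' hq' j' hn
    by_cases he : (q', j') = (q, j)
    · obtain ⟨rfl, rfl⟩ := Prod.mk.inj he
      exact hg
    · exact h.subgrad hs q' hq' j' fun hm => hn ⟨hm, he⟩
  iter := h.iter
  gap_pos := h.gap_pos
  conv := fun hst => absurd (hs.symm.trans hst) (by decide)
  no_parent := h.no_parent

/-- All that convergence needs from the procedure: a reduction presupposes `ρ > 1`. The counter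
plays no further role. -/
theorem reduceΔ_cases (q : ℕ) (Δcurr : ℝ) (counter : ℕ) :
    (H.reduceΔ P q Δcurr counter).1 = Δcurr ∨
      ∃ r, H.parent q = some r ∧ 1 < H.ρ P q r ∧
        (H.reduceΔ P q Δcurr counter).1 = min Δcurr (H.Δ q / min (H.ρ P q r) 4) := by
  unfold reduceΔ
  split
  · exact Or.inl rfl
  · rename_i r hr
    dsimp only
    split_ifs with h1 h2 h2
    · refine Or.inr ⟨r, hr, ?_, rfl⟩
      rcases h2 with h2 | h2
      · linarith
      · exact h2.2.1
    · exact Or.inl rfl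
    · refine Or.inr ⟨r, hr, ?_, rfl⟩
      rcases h2 with h2 | h2
      · linarith
      · exact h2.2.1
    · exact Or.inl rfl

theorem reduceΔ_le (q : ℕ) (Δcurr : ℝ) (counter : ℕ) :
    (H.reduceΔ P q Δcurr counter).1 ≤ Δcurr := by
  rcases H.reduceΔ_cases (P := P) q Δcurr counter with h | ⟨r, _, _, h⟩
  · exact h.le
  · exact h.le.trans (min_le_left _ _)

theorem reduceΔ_pos {Δcurr : ℝ} (counter : ℕ) (hΔ : 0 < Δcurr) (hq : 0 < H.Δ q) :
    0 < (H.reduceΔ P q Δcurr counter).1 := by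
  rcases H.reduceΔ_cases (P := P) q Δcurr counter with h | ⟨r, _, hρ, h⟩ <;> rw [h]
  · exact hΔ
  · exact lt_min hΔ (div_pos hq (lt_min (by linarith) (by norm_num)))

theorem IncreaseΔ.pos {Δ Δ' : ℝ} (h : H.IncreaseΔ P par q Δ Δ') (hΔ : 0 < Δ) : 0 < Δ' := by
  have hmax : 0 < max Δ (min par.Δhi (2 * H.Δ q)) := lt_max_of_lt_left hΔ
  unfold IncreaseΔ at h
  split at h
  · rcases h with rfl | ⟨_, rfl⟩ <;> assumption
  · rename_i r _
    by_cases ht : P.Q (H.x q) ≤ P.Q (H.x r) - 0.5 * (P.Q (H.x r) - H.m q) ∧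
        ‖H.x q - H.x r‖ = H.Δ q
    · rw [h.1 ht]; exact hmax
    · rw [h.2 ht]; exact hΔ

theorem CoreInvariant.trigger (h : H.CoreInvariant P par s) (hs : s.stopped = false)
    (hq : q ≤ s.k) (ht : H.Trigger P par q s s') : H.CoreInvariant P par s' := by
  have hns : ∀ {p : Prop}, s.stopped = true → p := fun hst =>
    absurd (hs.symm.trans hst) (by decide)
  cases ht with
  | accept M' Δ' full acc radius sub keep =>
    exact ⟨radius.pos h.Δcurr_pos, h.model_finite.subset sub, fun C hC => h.model_under C (sub hC),
      fun r hr => Option.some.inj hr ▸ hq, h.Δ_pos, h.feas, h.pool_le, h.count, h.subgrad, h.iter,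
      h.gap_pos, hns, fun hi => absurd hi (by simp)⟩
  | reject M' full rej upd =>
    exact ⟨reduceΔ_pos _ h.Δcurr_pos (h.Δ_pos q hq), h.model_finite.subset upd.1,
      fun C hC => h.model_under C (upd.1 hC), h.inc_le, h.Δ_pos, h.feas, h.pool_le, h.count,
      h.subgrad, h.iter, h.gap_pos, hns, h.no_parent⟩
  | fill test =>
    exact ⟨h.Δcurr_pos, h.model_finite, h.model_under, h.inc_le, h.Δ_pos, h.feas, h.pool_le,
      h.count, h.subgrad, h.iter, h.gap_pos, hns, h.no_parent⟩

theorem NewIterate.frame (hn : H.NewIterate P par s s') :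
    s'.k = s.k + 1 ∧ s'.inc = s.inc ∧ s'.model = s.model ∧ s'.Δcurr = s.Δcurr := by
  by_cases hc : H.ConvTest P par s.inc (s.k + 1)
  · rw [hn.halts hc]
    exact ⟨rfl, rfl, rfl, rfl⟩
  · rw [hn.go_on hc]
    exact ⟨rfl, rfl, rfl, rfl⟩

theorem NewIterate.running (hn : H.NewIterate P par s s') (hs' : s'.stopped = false) :
    ¬ H.ConvTest P par s.inc (s.k + 1) ∧
      s'.t = Function.update s.t (s.k + 1) 0 ∧ s'.pool = s.pool ∪ {τ | τ.1 = s.k + 1} := by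
  by_cases hc : H.ConvTest P par s.inc (s.k + 1)
  · rw [hn.halts hc] at hs'
    simp at hs'
  · refine ⟨hc, ?_⟩
    rw [hn.go_on hc]
    exact ⟨rfl, rfl⟩

theorem CoreInvariant.newIterate (h : H.CoreInvariant P par s) (hs : s.stopped = false)
    (hn : H.NewIterate P par s s') :
    H.CoreInvariant P par s' := by
  obtain ⟨hk, hinc, hmodel, hΔc⟩ := hn.frame
  have hle : ∀ {q'}, q' ≤ s'.k → q' ≤ s.k ∨ q' = s.k + 1 := fun hq' => by omega
  refine ⟨hΔc ▸ h.Δcurr_pos, hmodel ▸ h.model_finite, hmodel ▸ h.model_under, ?_, ?_, ?_, ?_, ?_,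
    ?_, ?_, ?_, ?_, ?_⟩
  · intro r hr
    have := h.inc_le r (hinc ▸ hr)
    omega
  · intro q' hq'
    rcases hle hq' with hq' | rfl
    · exact h.Δ_pos q' hq'
    · exact hn.Δ_eq ▸ h.Δcurr_pos
  · intro q' hq'
    rcases hle hq' with hq' | rfl
    · exact h.feas q' hq'
    · exact hn.solves.1.1
  · intro τ hτ
    by_cases hc : H.ConvTest P par s.inc (s.k + 1)
    · rw [hn.halts hc] at hτ
      have := h.pool_le τ hτ
      omega
    · rw [hn.go_on hc] at hτ
      rcases hτ with hτ | hτ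
      · have := h.pool_le τ hτ
        omega
      · exact hk ▸ (show τ.1 = s.k + 1 from hτ).le
  · intro hs' q' hq'
    obtain ⟨-, ht, hp⟩ := hn.running hs'
    rw [ht, hp]
    rcases hle hq' with hq' | rfl
    · have hne : q' ≠ s.k + 1 := by omega
      rw [Function.update_of_ne hne]
      refine Eq.trans ?_ (h.count hs q' hq')
      congr 2
      ext j'
      simp [hne]
    · rw [Function.update_self, zero_add]
      have : {j | (s.k + 1, j) ∈ s.pool ∪ {τ | τ.1 = s.k + 1}} = (Set.univ : Set (Fin T)) := by
        ext j'
        simp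
      rw [this, Set.ncard_univ, Nat.card_eq_fintype_card, Fintype.card_fin]
  · intro hs' q' hq' j' hj'
    obtain ⟨-, -, hp⟩ := hn.running hs'
    rw [hp] at hj'
    rcases hle hq' with hq' | rfl
    · exact h.subgrad hs q' hq' j' fun hm => hj' (Or.inl hm)
    · exact absurd (Or.inr rfl) hj'
  · intro q' hq' r hr
    rcases hle hq' with hq' | rfl
    · have := h.iter q' hq' r hr
      exact ⟨by omega, this.2⟩
    · have hr' : s.inc = some r := hn.parent_eq ▸ hr
      refine ⟨by have := h.inc_le r hr'; omega, ?_, ?_, ?_, ?_⟩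
      · exact hn.cuts_eq ▸ h.model_finite
      · exact hn.cuts_eq ▸ h.model_under
      · have := hn.solves
        rw [hr'] at this
        rw [hn.cuts_eq, hn.Δ_eq]
        exact this
      · rw [hn.cuts_eq]
        exact hn.m_eq (by simp [hr'])
  · intro htol hs' q' hq' r hr
    rcases hle hq' with hq' | rfl
    · exact h.gap_pos htol hs q' hq' r hr
    · by_contra! hneg
      exact (hn.running hs').1 ⟨r, hn.parent_eq ▸ hr, by rw [htol, zero_mul]; exact hneg⟩
  · intro hs'
    rw [hinc, hk]
    by_contra hc
    rw [hn.go_on hc] at hs'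
    exact absurd (hs.symm.trans hs') (by decide)
  · intro hi q' hq'
    rcases hle hq' with hq' | rfl
    · exact h.no_parent (hinc ▸ hi) q' hq'
    · rw [hn.parent_eq, ← hinc, hi]

theorem Init.invariant (h : H.Init P par s) (hP : P.Standing) : H.Invariant P par s where
  Δcurr_pos := h.Δ_pos
  model_finite := h.model_finite
  model_under := h.model_under
  inc_le := fun r hr => by simp [h.inc] at hr
  Δ_pos := by
    intro q hq
    obtain rfl : q = 0 := by simpa [h.k] using hq
    exact h.Δ_zero ▸ h.Δ_pos
  feas := by
    intro q hq
    obtain rfl : q = 0 := by simpa [h.k] using hq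
    exact h.start
  pool_le := by
    intro τ hτ
    rw [h.pool] at hτ
    exact h.k ▸ (show τ.1 = 0 from hτ).le
  count := by
    intro _ q hq
    obtain rfl : q = 0 := by simpa [h.k] using hq
    simp [h.t, h.pool]
  subgrad := by
    intro _ q hq j hj
    obtain rfl : q = 0 := by simpa [h.k] using hq
    simp [h.pool] at hj
  iter := by
    intro q hq r hr
    obtain rfl : q = 0 := by simpa [h.k] using hq
    simp [h.parent_zero] at hr
  gap_pos := by
    intro _ _ q hq r hr
    obtain rfl : q = 0 := by simpa [h.k] using hq
    simp [h.parent_zero] at hr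
  conv := fun hs => absurd (h.stopped.symm.trans hs) (by decide)
  no_parent := by
    intro _ q hq
    obtain rfl : q = 0 := by simpa [h.k] using hq
    exact h.parent_zero
  parent_k := by rw [h.k, h.inc, h.parent_zero]
  Δ_k := by rw [h.k, h.Δ_zero]
  cuts_sub := fun hne => absurd h.inc hne
  latest := fun _ => ⟨⟨0, hP.T_pos⟩, by simp [h.pool, h.k]⟩
  startup := fun _ _ => ⟨⟨0, hP.T_pos⟩, by simp [h.pool]⟩

theorem Trigger.frame (ht : H.Trigger P par q s s') :
    s'.k = s.k ∧ s'.stopped = s.stopped ∧ s'.pool = s.pool ∧ s'.t = s.t := by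
  cases ht <;> exact ⟨rfl, rfl, rfl, rfl⟩

theorem Invariant.act (h : H.Invariant P par s) (hs : s.stopped = false) (hP : P.Standing)
    (hqj : (q, j) ∈ s.pool) (hg : IsSubgradient (P.Qclus j) (H.x q) (H.g q j))
    (ha : H.Act P par q j s s') : H.Invariant P par s' := by
  have hrec := h.toCoreInvariant.record hs hqj hg
  have hqk : q ≤ s.k := h.pool_le _ hqj
  -- If the completed task does not finish `x^q`, every iterate with an open task still has one.
  have hopen : ∀ q', (∃ j', (q', j') ∈ s.pool) → (H.record P q j s).t q ≠ T →
      ∃ j', (q', j') ∈ (H.record P q j s).pool := by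
    rintro q' ⟨j', hj'⟩ hT
    rcases eq_or_ne q' q with rfl | hne
    · by_contra! hno
      exact hT ((hrec.full_iff hs hqk).2 hno)
    · exact ⟨j', hj', by simp [hne]⟩
  cases ha with
  | idle not_full not_fill =>
    exact
      { toCoreInvariant := hrec
        parent_k := h.parent_k
        Δ_k := h.Δ_k
        cuts_sub := fun hne => (h.cuts_sub hne).trans (Set.subset_insert _ _)
        latest := fun _ => hopen _ (h.latest hs) not_full
        startup := fun _ hi => hopen _ (h.startup hs hi) not_full }
  | generate s₂ _ trig new =>
    obtain ⟨hk₂, hs₂, hp₂, ht₂⟩ := trig.frame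
    obtain ⟨hk, hinc, hmodel, hΔc⟩ := new.frame
    exact
      { toCoreInvariant := (hrec.trigger hs hqk trig).newIterate (hs₂.trans hs) new
        parent_k := by rw [hk, hinc, new.parent_eq]
        Δ_k := by rw [hk, hΔc, new.Δ_eq]
        cuts_sub := fun _ => by rw [hk, hmodel, new.cuts_eq]
        latest := fun hs' => ⟨⟨0, hP.T_pos⟩, by rw [(new.running hs').2.2, hk]; exact Or.inr rfl⟩
        startup := by
          intro hs' hi
          rw [(new.running hs').2.2, hp₂]
          rw [hinc] at hi
          suffices ∃ j', (0, j') ∈ (H.record P q j s).pool by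
            obtain ⟨j', hj'⟩ := this
            exact ⟨j', Or.inl hj'⟩
          cases trig with
          | accept => simp at hi
          | reject M' full rej upd =>
            have hi' : s.inc = none := hi
            -- During startup both acceptance conditions are vacuous, so a fully evaluated point
            -- cannot be rejected.
            refine hopen 0 (h.startup hs hi') fun _ => rej ⟨fun r hr => ?_, fun r hr => ?_⟩
            · exact absurd (hi.symm.trans hr) (by simp)
            · exact absurd ((h.no_parent hi' q hqk).symm.trans hr) (by simp)
          | fill test => exact hopen 0 (h.startup hs hi) test.1 }

end History

/-! ### Completion of the evaluations -/

/-- Tasks are issued only for new indices, so a completed task never returns. -/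
theorem notMem_pool_of_le {u : ℕ → State n T} (hk : ∀ i, (u i).k ≤ (u (i + 1)).k)
    (hpool : ∀ i, ∀ τ ∈ (u (i + 1)).pool, τ ∈ (u i).pool ∨ (u i).k < τ.1)
    {i i' : ℕ} (hi : i ≤ i') {τ : ℕ × Fin T} (hτ : τ.1 ≤ (u i).k) (hn : τ ∉ (u i).pool) :
    τ ∉ (u i').pool := by
  induction i', hi using Nat.le_induction with
  | base => exact hn
  | succ i' hi ih =>
    have hle : (u i).k ≤ (u i').k := monotone_nat_of_le_succ (f := fun i => (u i).k) hk hi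
    intro hm
    rcases hpool i' τ hm with hm | hm
    · exact ih hm
    · omega

theorem TasksComplete.exists_evaluated {u : ℕ → State n T} (hfin : TasksComplete u)
    (hk : ∀ i, (u i).k ≤ (u (i + 1)).k)
    (hpool : ∀ i, ∀ τ ∈ (u (i + 1)).pool, τ ∈ (u i).pool ∨ (u i).k < τ.1)
    (hs : ∀ i, (u i).stopped = false) {i q : ℕ} (hq : q ≤ (u i).k) :
    ∃ i' ≥ i, ∀ j, (q, j) ∉ (u i').pool := by
  have hj : ∀ j, ∃ i' ≥ i, (q, j) ∉ (u i').pool := by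
    intro j
    by_cases hm : (q, j) ∈ (u i).pool
    · obtain ⟨i', hi', hst | hn⟩ := hfin i _ hm
      · exact absurd ((hs i').symm.trans hst) (by decide)
      · exact ⟨i', hi', hn⟩
    · exact ⟨i, le_rfl, hm⟩
  choose f hf hfn using hj
  refine ⟨i + ∑ j, f j, Nat.le_add_right _ _, fun j => ?_⟩
  have hle : f j ≤ ∑ j, f j := Finset.single_le_sum (fun _ _ => Nat.zero_le _) (Finset.mem_univ j)
  exact notMem_pool_of_le hk hpool (hle.trans (Nat.le_add_left _ _))
    (hq.trans (monotone_nat_of_le_succ (f := fun i => (u i).k) hk (hf j))) (hfn j)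

theorem TasksComplete.shift {u : ℕ → State n T} (hfin : TasksComplete u) (i : ℕ) :
    TasksComplete fun a => u (i + a) := by
  intro a τ hτ
  obtain ⟨i', hi', hc⟩ := hfin (i + a) τ hτ
  obtain ⟨b, rfl⟩ := Nat.exists_eq_add_of_le (show i ≤ i' by omega)
  exact ⟨b, by omega, hc⟩

namespace History

variable {H : History n T} {P : TwoStageLP n m₁ n₂ m₂ N T} {par : Params} {s s' : State n T}
  {q r : ℕ} {j : Fin T}

/-! ### Termination -/

/-- When the algorithm stops, its last model certifies the optimality of the incumbent. -/
theorem Invariant.certificate (h : H.Invariant P par s) (hs : s.stopped = true)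
    (htol : par.εtol = 0) (hr : s.inc = some r) :
    0 < H.Δ s.k ∧ (∀ x, P.model (H.cuts s.k) x ≤ (P.Q x : EReal)) ∧
      ∀ x ∈ P.trustRegion (H.x r) (H.Δ s.k), (P.Q (H.x r) : EReal) ≤ P.model (H.cuts s.k) x := by
  obtain ⟨r', hr', hconv⟩ := h.conv hs
  obtain rfl : r = r' := Option.some.inj (hr.symm.trans hr')
  rw [htol, zero_mul, sub_nonpos] at hconv
  have hspec := (h.iter s.k le_rfl r (h.parent_k.trans hr)).2
  refine ⟨h.Δ_pos _ le_rfl, TwoStageLP.model_le_Q hspec.under, fun x hx => ?_⟩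
  exact (EReal.coe_le_coe_iff.2 hconv).trans (hspec.m_eq.le.trans (hspec.solves.2 x hx))

/-- The certificate makes the incumbent minimal in a trust region of positive radius, whereas a
non-optimal point admits a decrease in every such region. -/
theorem Invariant.optimal (h : H.Invariant P par s) (hP : P.Standing) (hs : s.stopped = true)
    (htol : par.εtol = 0) : ∃ r, s.inc = some r ∧ H.x r ∈ P.solutionSet := by
  obtain ⟨r, hr, -⟩ := h.conv hs
  refine ⟨r, hr, ?_⟩
  by_contra hS
  obtain ⟨hΔ, hle, hge⟩ := h.certificate hs htol hr
  obtain ⟨κ, hκ, hdec⟩ := hP.exists_decrease (h.feas r (h.inc_le r hr)) hS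
  obtain ⟨x, hx, hQ⟩ := hdec _ hΔ
  have h1 := EReal.coe_le_coe_iff.1 ((hge x hx).trans (hle x))
  have h2 : 0 < min 1 (H.Δ s.k) * κ := mul_pos (lt_min one_pos hΔ) hκ
  linarith

theorem Act.inc_cases (ha : H.Act P par q j s s') :
    s'.inc = s.inc ∨ s'.inc = some q ∧ H.Accept P par s.inc q := by
  cases ha with
  | idle => exact Or.inl rfl
  | generate s₂ _ trig new =>
    rw [new.frame.2.1]
    cases trig with
    | accept M' Δ' full acc => exact Or.inr ⟨rfl, acc⟩
    | reject => exact Or.inl rfl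
    | fill => exact Or.inl rfl

theorem Act.k_le_and_pool (ha : H.Act P par q j s s') (hs' : s'.stopped = false) :
    s.k ≤ s'.k ∧ ∀ τ ∈ s'.pool, τ ∈ s.pool ∨ s.k < τ.1 := by
  cases ha with
  | idle => exact ⟨le_rfl, fun τ hτ => Or.inl hτ.1⟩
  | generate s₂ _ trig new =>
    obtain ⟨hk₂, -, hp₂, -⟩ := trig.frame
    have hk₂' : s₂.k = s.k := hk₂
    have hk := new.frame.1
    refine ⟨by omega, fun τ hτ => ?_⟩
    rw [(new.running hs').2.2, hp₂] at hτ
    rcases hτ with hτ | hτ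
    · exact Or.inl hτ.1
    · have : τ.1 = s₂.k + 1 := hτ
      exact Or.inr (by omega)

/-! ### Periods with a fixed incumbent -/

variable (H P par) in
/-- A completed task that leaves the incumbent as it is. -/
structure QuietStep (q : ℕ) (j : Fin T) (s s' : State n T) : Prop where
  k_cases : s'.k = s.k ∨ s'.k = s.k + 1
  pool : s'.pool = (s.pool \ {(q, j)}) ∪ {τ | s.k < τ.1 ∧ τ.1 ≤ s'.k}
  keep : ∀ C ∈ insert (H.cut P q j) s.model,
    H.Protected P par s.k C → C ∈ s'.model
  cuts : s'.k = s.k + 1 → H.cuts s'.k = s'.model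
  Δ_le : H.Δ s'.k ≤ H.Δ s.k
  Δ_ge : H.Δ s'.k = H.Δ s.k ∨ ∃ r, H.parent q = some r ∧ 1 < H.ρ P q r ∧
    min (H.Δ s.k) (H.Δ q / 4) ≤ H.Δ s'.k
  reject : (∀ j', (q, j') ∉ s'.pool) → ¬ H.Accept P par s.inc q

theorem Act.quietStep (h : H.Invariant P par s) (hs : s.stopped = false)
    (hqj : (q, j) ∈ s.pool) (hg : IsSubgradient (P.Qclus j) (H.x q) (H.g q j))
    (ha : H.Act P par q j s s') (hs' : s'.stopped = false) (hinc : s.inc = some r)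
    (hinc' : s'.inc = some r) : H.QuietStep P par q j s s' := by
  have hrec := h.toCoreInvariant.record hs hqj hg
  have hqk : q ≤ s.k := h.pool_le _ hqj
  cases ha with
  | idle not_full not_fill =>
    refine ⟨Or.inl rfl, ?_, fun C hC _ => hC, fun hk => ?_, le_rfl, Or.inl rfl, fun hno => ?_⟩
    · have : {τ : ℕ × Fin T | s.k < τ.1 ∧ τ.1 ≤ s.k} = ∅ :=
        Set.eq_empty_of_forall_notMem fun τ hτ => absurd hτ.1 (not_lt.2 hτ.2)
      exact (this ▸ (Set.union_empty _).symm :)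
    · exact absurd hk (Nat.succ_ne_self _).symm
    · exact absurd ((hrec.full_iff hs hqk).2 hno) not_full
  | generate s₂ _ trig new =>
    obtain ⟨hk₂, hs₂, hp₂, ht₂⟩ := trig.frame
    obtain ⟨hk, hi, hmodel, hΔc⟩ := new.frame
    have hk₂' : s₂.k = s.k := hk₂
    have hp : s'.pool = (s.pool \ {(q, j)}) ∪ {τ | s.k < τ.1 ∧ τ.1 ≤ s'.k} := by
      rw [(new.running hs').2.2, hp₂, hk, hk₂']
      congr 1
      ext τ
      simp only [Set.mem_ofPred_eq]
      omega
    have hΔ : H.Δ s'.k = s₂.Δcurr := by rw [hk, new.Δ_eq]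
    have hcuts : H.cuts s'.k = s'.model := by rw [hk, hmodel, new.cuts_eq]
    cases trig with
    | accept M' Δ' full acc =>
      exfalso
      -- Accepting `q` while keeping the incumbent would mean `q = r`, hence `Q(x^r) < Q(x^r)`. So
      -- the radius never increases in a quiet period.
      obtain rfl : q = r := Option.some.inj (hi.symm.trans hinc')
      exact lt_irrefl _ (acc.1 q hinc)
    | reject M' full rej upd =>
      refine ⟨Or.inr (by omega), hp, fun C hC hpr => ?_, fun _ => hcuts, ?_, ?_, fun _ => rej⟩
      · rw [hmodel]
        exact upd.2 C hC hpr
      · rw [hΔ, h.Δ_k]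
        exact reduceΔ_le _ _ _
      · rw [hΔ, h.Δ_k]
        refine (reduceΔ_cases q s.Δcurr s.counter).imp id ?_
        rintro ⟨r', hr', hρ, he⟩
        refine ⟨r', hr', hρ, ?_⟩
        refine le_trans (min_le_min le_rfl ?_) he.ge
        exact div_le_div_of_nonneg_left (h.Δ_pos q hqk).le (lt_min (by linarith) (by norm_num))
          (min_le_right _ _)
    | fill test =>
      refine ⟨Or.inr (by omega), hp, fun C hC _ => by rw [hmodel]; exact hC, fun _ => hcuts, ?_,
        Or.inl ?_, fun hno => absurd ((hrec.full_iff hs hqk).2 fun j' hj' => hno j' ?_) test.1⟩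
      · rw [hΔ, h.Δ_k]
        exact le_rfl
      · rw [hΔ, h.Δ_k]
        rfl
      · rw [hp]
        exact Or.inl hj'

variable (H P par) in
/-- A run, from some moment on, that never stops and keeps the incumbent `r`. -/
structure QuietRun (u : ℕ → State n T) (r : ℕ) : Prop where
  inv : ∀ i, H.Invariant P par (u i)
  running : ∀ i, (u i).stopped = false
  inc : ∀ i, (u i).inc = some r
  step : ∀ i, ∃ q j, (q, j) ∈ (u i).pool ∧ H.QuietStep P par q j (u i) (u (i + 1))
  complete : TasksComplete u

/-! ### Indices, radii and gaps under a fixed incumbent -/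

namespace QuietRun

variable {u : ℕ → State n T}

theorem k_le_succ (h : H.QuietRun P par u r) (i : ℕ) : (u i).k ≤ (u (i + 1)).k := by
  obtain ⟨q, j, -, hst⟩ := h.step i
  rcases hst.k_cases with hk | hk <;> omega

theorem k_mono (h : H.QuietRun P par u r) : Monotone fun i => (u i).k :=
  monotone_nat_of_le_succ h.k_le_succ

theorem mem_pool_of_succ (h : H.QuietRun P par u r) (i : ℕ) (τ : ℕ × Fin T)
    (hτ : τ ∈ (u (i + 1)).pool) : τ ∈ (u i).pool ∨ (u i).k < τ.1 := by
  obtain ⟨q, j, -, hst⟩ := h.step i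
  rw [hst.pool] at hτ
  exact hτ.imp (fun hm => hm.1) fun hm => hm.1

theorem notMem_pool (h : H.QuietRun P par u r) {i i' : ℕ} (hi : i ≤ i') {τ : ℕ × Fin T}
    (hτ : τ.1 ≤ (u i).k) (hn : τ ∉ (u i).pool) : τ ∉ (u i').pool :=
  notMem_pool_of_le h.k_le_succ h.mem_pool_of_succ hi hτ hn

theorem exists_evaluated (h : H.QuietRun P par u r) {i : ℕ} (hq : q ≤ (u i).k) :
    ∃ i' ≥ i, ∀ j, (q, j) ∉ (u i').pool :=
  h.complete.exists_evaluated h.k_le_succ h.mem_pool_of_succ h.running hq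

/-- The latest iterate always has an open task; once its present tasks are all complete, a newer
iterate must exist. -/
theorem k_unbounded (h : H.QuietRun P par u r) (k : ℕ) : ∃ i, k ≤ (u i).k := by
  induction k with
  | zero => exact ⟨0, Nat.zero_le _⟩
  | succ k ih =>
    obtain ⟨i, hi⟩ := ih
    obtain ⟨i', hi', hno⟩ := h.exists_evaluated (le_refl (u i).k)
    refine ⟨i', Nat.succ_le_of_lt (lt_of_le_of_lt hi (lt_of_le_of_ne (h.k_mono hi') fun he => ?_))⟩
    obtain ⟨j, hj⟩ := (h.inv i').latest (h.running i')
    exact hno j ((show (u i).k = (u i').k from he) ▸ hj)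

/-- The index grows by at most one per event and is unbounded, so it skips no value. The event found
is the one that generates iterate `k + 1`. -/
theorem exists_generation (h : H.QuietRun P par u r) {i k : ℕ} (hk : (u i).k ≤ k) :
    ∃ i' ≥ i, (u i').k = k ∧ (u (i' + 1)).k = k + 1 := by
  classical
  have hex : ∃ a, k < (u (i + a)).k := by
    obtain ⟨a, ha⟩ := h.k_unbounded (k + 1)
    exact ⟨a, lt_of_lt_of_le (Nat.lt_of_succ_le ha) (h.k_mono (Nat.le_add_left a i))⟩
  have hspec := Nat.find_spec hex
  obtain ⟨b, hb⟩ : ∃ b, Nat.find hex = b + 1 := by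
    refine Nat.exists_eq_succ_of_ne_zero fun h0 => ?_
    rw [h0, add_zero] at hspec
    omega
  rw [hb] at hspec
  have hmin : (u (i + b)).k ≤ k := not_lt.1 (Nat.find_min hex (by omega))
  obtain ⟨q, j, -, hst⟩ := h.step (i + b)
  refine ⟨i + b, Nat.le_add_right _ _, ?_⟩
  rw [← add_assoc] at hspec
  rcases hst.k_cases with hc | hc <;> omega

theorem parent_eq (h : H.QuietRun P par u r) {k : ℕ} (hk : (u 0).k ≤ k) :
    H.parent k = some r := by
  obtain ⟨i, -, rfl, -⟩ := h.exists_generation hk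
  exact (h.inv i).parent_k.trans (h.inc i)

theorem iterateSpec (h : H.QuietRun P par u r) {k : ℕ} (hk : (u 0).k ≤ k) :
    H.IterateSpec P k r := by
  have hp := h.parent_eq hk
  obtain ⟨i, -, rfl, -⟩ := h.exists_generation hk
  exact ((h.inv i).iter _ le_rfl r hp).2

theorem gap_pos (h : H.QuietRun P par u r) (htol : par.εtol = 0) {k : ℕ} (hk : (u 0).k ≤ k) :
    0 < P.Q (H.x r) - H.m k := by
  have hp := h.parent_eq hk
  obtain ⟨i, -, rfl, -⟩ := h.exists_generation hk
  exact (h.inv i).gap_pos htol (h.running i) _ le_rfl r hp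

theorem center_feasible (h : H.QuietRun P par u r) : H.x r ∈ P.feasible :=
  (h.inv 0).feas r ((h.inv 0).inc_le r (h.inc 0))

theorem Δ_pos (h : H.QuietRun P par u r) {k : ℕ} (hk : (u 0).k ≤ k) : 0 < H.Δ k := by
  obtain ⟨i, -, rfl, -⟩ := h.exists_generation hk
  exact (h.inv i).Δ_pos _ le_rfl

theorem Δ_succ_le (h : H.QuietRun P par u r) {k : ℕ} (hk : (u 0).k ≤ k) :
    H.Δ (k + 1) ≤ H.Δ k := by
  obtain ⟨i, -, hi, hi'⟩ := h.exists_generation hk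
  obtain ⟨q, j, -, hst⟩ := h.step i
  rw [← hi', ← hi]
  exact hst.Δ_le

theorem Δ_le (h : H.QuietRun P par u r) {k : ℕ} (hk : (u 0).k ≤ k) : H.Δ k ≤ H.Δ (u 0).k := by
  induction k, hk using Nat.le_induction with
  | base => exact le_rfl
  | succ k hk ih => exact (h.Δ_succ_le hk).trans ih

/-- The next trust region is contained in the present one, and the next model retains the cuts
active at `x^k`. -/
theorem m_le_succ (h : H.QuietRun P par u r) {k : ℕ} (hk : (u 0).k ≤ k) :
    H.m k ≤ H.m (k + 1) := by
  have hspec := h.iterateSpec hk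
  have hspec' : H.IterateSpec P (k + 1) r := h.iterateSpec (hk.trans (Nat.le_succ k))
  have hΔ := h.Δ_succ_le hk
  obtain ⟨i, -, hi, hi'⟩ := h.exists_generation hk
  obtain ⟨q, j, -, hst⟩ := h.step i
  rw [← EReal.coe_le_coe_iff, hspec'.m_eq]
  refine hspec.solves.le_model_of_active hspec.finite hspec.m_eq (fun C hC hact => ?_)
    ⟨hspec'.solves.1.1, hspec'.solves.1.2.trans hΔ⟩
  rw [← hi', hst.cuts (by omega)]
  refine hst.keep C (Or.inr ((h.inv i).cuts_sub (by simp [h.inc i]) (hi ▸ hC))) ?_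
  rw [hi]
  exact Or.inr (Or.inl ⟨hC, hact⟩)

theorem gap_antitoneOn (h : H.QuietRun P par u r) :
    AntitoneOn (fun k => P.Q (H.x r) - H.m k) (Set.Ici (u 0).k) := by
  intro a ha b hb hab
  induction b, hab using Nat.le_induction with
  | base => exact le_rfl
  | succ b hab ih =>
    have hb' : (u 0).k ≤ b := le_trans ha hab
    have := ih hb'
    have := h.m_le_succ hb'
    dsimp only at *
    linarith

/-- An iterate that has been evaluated completely has failed the acceptance test. -/
theorem rejected (h : H.QuietRun P par u r) (htol : par.εtol = 0) (hP : P.Standing) (i : ℕ) :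
    ∀ l, (u 0).k < l → l ≤ (u i).k → (∀ j, (l, j) ∉ (u i).pool) →
      P.Q (H.x r) - par.ξ * (P.Q (H.x r) - H.m l) < P.Q (H.x l) := by
  induction i with
  | zero => intro l hl hl'; omega
  | succ i ih =>
    intro l hl hl' hno
    obtain ⟨q, j, -, hst⟩ := h.step i
    have hli : l ≤ (u i).k := by
      by_contra! hlt
      refine hno ⟨0, hP.T_pos⟩ ?_
      rw [hst.pool]
      exact Or.inr ⟨hlt, hl'⟩
    rcases eq_or_ne l q with rfl | hne
    -- With a positive gap, sufficient decrease implies the strict decrease that acceptance also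
    -- requires.
    · by_contra! hle
      refine hst.reject hno ⟨fun r' hr' => ?_, fun r' hr' => ?_⟩
      · obtain rfl : r = r' := Option.some.inj ((h.inc i).symm.trans hr')
        have := mul_pos par.ξ_pos (h.gap_pos htol hl.le)
        linarith
      · obtain rfl : r = r' := Option.some.inj ((h.parent_eq hl.le).symm.trans hr')
        exact hle
    · refine ih l hl hli fun j' hj' => hno j' ?_
      rw [hst.pool]
      exact Or.inl ⟨hj', by simp [hne]⟩

/-- If the gap does not become small in comparison with the gap of the iterate at which a cut was
generated, then the cut is never deleted. -/
theorem cut_mem_model (h : H.QuietRun P par u r) {K : ℕ}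
    (hK : ∀ k ≥ (u 0).k, ∀ l ≥ K,
      P.Q (H.x r) - H.m k > par.η * (P.Q (H.x r) - H.m l)) (i : ℕ) :
    ∀ l, (u 0).k < l → K ≤ l → l ≤ (u i).k → ∀ j, (l, j) ∉ (u i).pool →
      H.cut P l j ∈ (u i).model := by
  induction i with
  | zero => intro l hl _ hl'; omega
  | succ i ih =>
    intro l hl hKl hl' j hno
    obtain ⟨q, j₀, -, hst⟩ := h.step i
    rw [hst.pool] at hno
    have hli : l ≤ (u i).k := by
      by_contra! hlt
      exact hno (Or.inr ⟨hlt, hl'⟩)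
    refine hst.keep _ ?_ (Or.inr (Or.inr ⟨r, l, ?_, rfl, h.parent_eq hl.le, ?_⟩))
    · by_cases he : (l, j) = (q, j₀)
      · obtain ⟨rfl, rfl⟩ := Prod.mk.inj he
        exact Set.mem_insert _ _
      · exact Or.inr (ih l hl hKl hli j fun hm => hno (Or.inl ⟨hm, he⟩))
    · exact (h.inv i).parent_k.trans (h.inc i)
    · exact hK _ (h.k_mono (Nat.zero_le i)) l hKl

/-! ### Convergence of the gap and optimality of a permanent incumbent -/

theorem exists_Q_oscillation (hP : P.Standing) (z : Fin n → ℝ) (R : ℝ) :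
    ∃ D > 0, ∀ y : Fin n → ℝ, ‖y - z‖ ≤ R → ∀ v : Fin n → ℝ, ‖v‖ ≤ 1 →
      P.Q (y + v) - P.Q y ≤ D := by
  obtain ⟨M, hM⟩ := (isCompact_closedBall z (R + 1)).exists_bound_of_continuousOn
    hP.continuous_Q.continuousOn
  refine ⟨2 * |M| + 1, by positivity, fun y hy v hv => ?_⟩
  have h1 := hM (y + v) (by
    rw [Metric.mem_closedBall, dist_eq_norm]
    calc ‖y + v - z‖ = ‖(y - z) + v‖ := by congr 1; abel
      _ ≤ R + 1 := (norm_add_le _ _).trans (add_le_add hy hv))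
  have h2 := hM y (by
    rw [Metric.mem_closedBall, dist_eq_norm]
    linarith)
  rw [Real.norm_eq_abs] at h1 h2
  have := (abs_le.1 h1).2
  have := (abs_le.1 h2).1
  have := le_abs_self M
  linarith

theorem gap_tendsto_zero (h : H.QuietRun P par u r) (htol : par.εtol = 0) (hP : P.Standing) :
    Filter.Tendsto (fun k => P.Q (H.x r) - H.m k) Filter.atTop (nhds 0) := by
  set gap : ℕ → ℝ := fun k => P.Q (H.x r) - H.m k with hgap
  set k₀ := (u 0).k with hk₀
  have hanti : ∀ a b, k₀ ≤ a → a ≤ b → gap b ≤ gap a := fun a b ha hab =>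
    h.gap_antitoneOn ha (le_trans ha hab) hab
  have hbdd : BddBelow (gap '' Set.Ici k₀) := ⟨0, by
    rintro _ ⟨k, hk, rfl⟩
    exact (h.gap_pos htol hk).le⟩
  set γ := sInf (gap '' Set.Ici k₀) with hγ
  have hγle : ∀ k ≥ k₀, γ ≤ gap k := fun k hk => csInf_le hbdd ⟨k, hk, rfl⟩
  have hne : (gap '' Set.Ici k₀).Nonempty := ⟨_, k₀, Set.self_mem_Ici, rfl⟩
  have hγ0 : 0 ≤ γ := le_csInf hne (by
    rintro _ ⟨k, hk, rfl⟩
    exact (h.gap_pos htol hk).le)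
  have hlim : ∀ ε > 0, ∃ K ≥ k₀, gap K < γ + ε := by
    intro ε hε
    obtain ⟨_, ⟨K, hK, rfl⟩, hlt⟩ := exists_lt_of_csInf_lt hne (lt_add_of_pos_right γ hε)
    exact ⟨K, hK, hlt⟩
  rcases hγ0.eq_or_lt with h0 | hpos
  · rw [Metric.tendsto_atTop]
    intro ε hε
    obtain ⟨K, hK, hlt⟩ := hlim ε hε
    refine ⟨K, fun k hk => ?_⟩
    have h1 := hanti K k hK hk
    have h2 := hγle k (hK.trans hk)
    rw [Real.dist_eq, abs_lt]
    constructor <;> linarith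
  exfalso
  -- One constant below `1` serves both purposes: `η` governs cut retention, `ξ` the failed
  -- acceptance test.
  obtain ⟨μ, hμ0, hμ1, hημ, hξμ⟩ : ∃ μ > 0, μ < 1 ∧ par.η ≤ μ ∧ par.ξ ≤ μ :=
    ⟨max par.η par.ξ, lt_max_of_lt_right par.ξ_pos,
      max_lt par.η_lt (by linarith [par.ξ_lt]), le_max_left _ _, le_max_right _ _⟩
  obtain ⟨K, hK, hlt⟩ := hlim (γ / μ - γ) (by
    rw [gt_iff_lt, sub_pos, lt_div_iff₀ hμ0]
    nlinarith)
  have hμK : μ * gap K < γ := by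
    have : gap K < γ / μ := by linarith
    rw [lt_div_iff₀ hμ0] at this
    linarith
  have hμl : ∀ l ≥ K, ∀ ν ≤ μ, ν * gap l ≤ μ * gap K := by
    intro l hl ν hν
    have h1 := hanti K l hK hl
    have h2 := hγle l (hK.trans hl)
    exact (mul_le_mul_of_nonneg_right hν (by linarith)).trans
      (mul_le_mul_of_nonneg_left h1 hμ0.le)
  have hkeep := h.cut_mem_model (K := K) fun k hk l hl =>
    lt_of_le_of_lt (hμl l hl _ hημ) (hμK.trans_le (hγle k hk))
  obtain ⟨D, hD0, hD⟩ := exists_Q_oscillation hP (H.x r) (H.Δ k₀)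
  have hball : ∀ k ≥ k₀, ‖H.x k - H.x r‖ ≤ H.Δ k₀ := fun k hk =>
    (h.iterateSpec hk).solves.1.2.trans (h.Δ_le hk)
  obtain ⟨a, -, φ, hφ, hconv⟩ := (isCompact_closedBall (H.x r) (H.Δ k₀)).tendsto_subseq
    (x := fun k => H.x (K + 1 + k)) fun k => by
      rw [Metric.mem_closedBall, dist_eq_norm]
      exact hball _ (by omega)
  -- Closeness at which the loss `D * ‖x^k - x^l‖` is smaller than the margin `γ - μ * gap K` left
  -- by rejection.
  have hε : 0 < (γ - μ * gap K) / D := div_pos (by linarith) hD0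
  obtain ⟨n₀, hn₀⟩ := Metric.cauchySeq_iff.1 hconv.cauchySeq _ hε
  have hl₀ : k₀ < K + 1 + φ n₀ := by omega
  set l := K + 1 + φ n₀ with hl
  obtain ⟨i₀, hi₀⟩ := h.k_unbounded l
  obtain ⟨i₁, hi₁, hno⟩ := h.exists_evaluated hi₀
  -- Iterate `K + 1 + φ b` is close to `x^l` and is generated after all tasks of `x^l` are complete,
  -- so its model contains every cut from `x^l`.
  set b := max n₀ (u i₁).k with hb
  have hφb : b ≤ φ b := hφ.id_le b
  have hkb : (u i₁).k ≤ K + φ b := by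
    have := le_max_right n₀ (u i₁).k
    omega
  obtain ⟨i, hi, hik, hik'⟩ := h.exists_generation hkb
  have hkk : K + φ b + 1 = K + 1 + φ b := by omega
  rw [hkk] at hik'
  have hlk₁ : l ≤ (u i₁).k := hi₀.trans (h.k_mono hi₁)
  have hno' : ∀ j, (l, j) ∉ (u (i + 1)).pool := fun j =>
    h.notMem_pool (by omega) hlk₁ (hno j)
  have hlk : l ≤ (u (i + 1)).k := hlk₁.trans (h.k_mono (by omega))
  have hrej := h.rejected htol hP (i + 1) l hl₀ hlk hno'
  have hk0 : k₀ ≤ K + 1 + φ b := by omega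
  have hspec := h.iterateSpec hk0
  obtain ⟨q, j, -, hst⟩ := h.step i
  have hlow := TwoStageLP.le_model_of_subgradients (M := H.cuts (K + 1 + φ b)) (z := H.x l)
    (g := H.g l) (fun j => (h.inv (i + 1)).subgrad (h.running _) l hlk j (hno' j))
    (fun j => ⟨H.cut P l j, by
      rw [← hik', hst.cuts (by omega)]
      exact hkeep (i + 1) l hl₀ (by omega) hlk j (hno' j), rfl, cut_val l j⟩)
    (hD _ (hball l hl₀.le)) (H.x (K + 1 + φ b))
  rw [← hspec.m_eq, EReal.coe_le_coe_iff] at hlow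
  have hdist := hn₀ b (le_max_left _ _) n₀ le_rfl
  rw [dist_eq_norm, lt_div_iff₀ hD0] at hdist
  simp only [Function.comp_apply] at hdist
  have h1 := hμl l (by omega) _ hξμ
  have h2 := hγle _ hk0
  simp only [hgap] at h1 h2 hdist
  linarith

/-- The radius stays bounded away from zero if the incumbent is not optimal. -/
theorem exists_Δ_lower_bound (h : H.QuietRun P par u r) (htol : par.εtol = 0) (hP : P.Standing)
    (hS : H.x r ∉ P.solutionSet) : ∃ δ > 0, ∀ k ≥ (u 0).k, δ ≤ H.Δ k := by
  obtain ⟨κ, hκ, hdec⟩ := hP.exists_decrease h.center_feasible hS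
  obtain ⟨ε, hε, hcont⟩ := Metric.continuous_iff.1 hP.continuous_Q (H.x r) κ hκ
  -- Older iterates, possibly with other parents, may still trigger reductions when their evaluation
  -- ends; there are finitely many of them.
  obtain ⟨d, hd, hdle⟩ : ∃ d > 0, ∀ q ≤ (u 0).k, d ≤ H.Δ q := by
    obtain ⟨q, hq, hmin⟩ := Finset.exists_min_image (Finset.range ((u 0).k + 1)) H.Δ
      ⟨0, by simp⟩
    refine ⟨H.Δ q, (h.inv 0).Δ_pos q (by simpa [Nat.lt_succ_iff] using hq), fun q' hq' =>
      hmin q' (by simpa [Nat.lt_succ_iff] using hq')⟩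
  have hbig : ∀ q ≥ (u 0).k, 1 < H.ρ P q r → ε ≤ H.Δ q := by
    intro q hq hρ
    by_contra! hlt
    have hspec := h.iterateSpec hq
    have hgap := h.gap_pos htol hq
    have hmin : 0 < min 1 (H.Δ q) := lt_min one_pos (h.Δ_pos hq)
    obtain ⟨x, hx, hQ⟩ := hdec _ (h.Δ_pos hq)
    have hm := hspec.m_le_Q hx
    have hQq : P.Q (H.x q) - P.Q (H.x r) < κ := by
      have := hcont (H.x q) (by
        rw [dist_eq_norm]
        exact hspec.solves.1.2.trans_lt hlt)
      rw [Real.dist_eq] at this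
      exact (le_abs_self _).trans_lt this
    rw [ρ, ← mul_div_assoc, one_lt_div hgap] at hρ
    have := mul_lt_mul_of_pos_left hQq hmin
    linarith
  -- A reduction divides the radius `Δ_q` of the triggering iterate, itself at least `min d ε`, by
  -- at most `4`; hence the factors do not accumulate.
  refine ⟨min d ε / 4, by positivity, ?_⟩
  have hinv : ∀ i, min d ε / 4 ≤ H.Δ (u i).k := by
    intro i
    induction i with
    | zero =>
      have h1 := hdle _ (le_refl (u 0).k)
      have h2 := min_le_left d ε
      linarith
    | succ i ih =>
      obtain ⟨q, j, hqj, hst⟩ := h.step i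
      rcases hst.Δ_ge with he | ⟨r', hr', hρ, hle⟩
      · rw [he]
        exact ih
      · refine le_trans (le_min ih ?_) hle
        gcongr
        rcases le_total q (u 0).k with hq | hq
        · exact (min_le_left _ _).trans (hdle q hq)
        · obtain rfl : r = r' := Option.some.inj ((h.parent_eq hq).symm.trans hr')
          exact (min_le_right _ _).trans (hbig q hq hρ)
  intro k hk
  obtain ⟨i, -, rfl, -⟩ := h.exists_generation hk
  exact hinv i

/-- At a non-optimal center, radii at least `δ` keep the gap above `min 1 δ * κ`, although it tends
to zero. -/
theorem center_optimal (h : H.QuietRun P par u r) (htol : par.εtol = 0) (hP : P.Standing) :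
    H.x r ∈ P.solutionSet := by
  by_contra hS
  obtain ⟨δ, hδ, hΔ⟩ := h.exists_Δ_lower_bound htol hP hS
  obtain ⟨κ, hκ, hdec⟩ := hP.exists_decrease h.center_feasible hS
  have hpos : 0 < min 1 δ * κ := mul_pos (lt_min one_pos hδ) hκ
  obtain ⟨k, hk, hk₀⟩ := (((h.gap_tendsto_zero htol hP).eventually (gt_mem_nhds hpos)).and
    (Filter.eventually_ge_atTop (u 0).k)).exists
  obtain ⟨x, hx, hQ⟩ := hdec _ (h.Δ_pos hk₀)
  have hm := (h.iterateSpec hk₀).m_le_Q hx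
  have := mul_le_mul_of_nonneg_right (min_le_min (le_refl (1 : ℝ)) (hΔ k hk₀)) hκ.le
  linarith

end QuietRun

/-! ### Runs -/

variable {u : ℕ → State n T}

theorem IsRun.invariant (hrun : H.IsRun P par u) (hP : P.Standing) (i : ℕ) :
    H.Invariant P par (u i) := by
  induction i with
  | zero => exact hrun.init.invariant hP
  | succ i ih =>
    cases hs : (u i).stopped with
    | true => exact hrun.halt i hs ▸ ih
    | false =>
      obtain ⟨q, j, hqj, hg, ha⟩ := hrun.step i hs
      exact ih.act hs hP hqj hg ha

theorem IsRun.inc_succ (hrun : H.IsRun P par u) (hP : P.Standing) (i : ℕ) :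
    (u (i + 1)).inc = (u i).inc ∨
      ∃ q ≤ (u i).k, (u (i + 1)).inc = some q ∧ H.Accept P par (u i).inc q := by
  cases hs : (u i).stopped with
  | true => exact Or.inl (by rw [hrun.halt i hs])
  | false =>
    obtain ⟨q, j, hqj, -, ha⟩ := hrun.step i hs
    exact ha.inc_cases.imp id fun hq => ⟨q, (hrun.invariant hP i).pool_le _ hqj, hq⟩

theorem IsRun.quietRun (hrun : H.IsRun P par u) (hP : P.Standing) (hfin : TasksComplete u)
    {i : ℕ} (hs : ∀ i' ≥ i, (u i').stopped = false) (hinc : ∀ i' ≥ i, (u i').inc = some r) :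
    H.QuietRun P par (fun a => u (i + a)) r where
  inv := fun a => hrun.invariant hP _
  running := fun a => hs _ (Nat.le_add_right _ _)
  inc := fun a => hinc _ (Nat.le_add_right _ _)
  step := by
    intro a
    obtain ⟨q, j, hqj, hg, ha⟩ := hrun.step (i + a) (hs _ (Nat.le_add_right _ _))
    exact ⟨q, j, hqj, ha.quietStep (hrun.invariant hP _) (hs _ (Nat.le_add_right _ _)) hqj hg
      (hs _ (by omega)) (hinc _ (Nat.le_add_right _ _)) (hinc _ (by omega))⟩
  complete := hfin.shift i

/-- The dummy incumbent is replaced. -/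
theorem IsRun.exists_inc_ne_none (hrun : H.IsRun P par u) (hP : P.Standing)
    (hfin : TasksComplete u) (i : ℕ) : ∃ i' > i, (u i').inc ≠ none := by
  by_contra! hnone
  have hs : ∀ a, (u (i + 1 + a)).stopped = false := by
    intro a
    by_contra hst
    obtain ⟨r, hr, -⟩ := (hrun.invariant hP _).conv (Bool.not_eq_false _ ▸ hst)
    exact absurd ((hnone _ (by omega)).symm.trans hr) (by simp)
  have hstep : ∀ a, (u (i + 1 + a)).k ≤ (u (i + 1 + (a + 1))).k ∧
      ∀ τ ∈ (u (i + 1 + (a + 1))).pool,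
        τ ∈ (u (i + 1 + a)).pool ∨ (u (i + 1 + a)).k < τ.1 := by
    intro a
    obtain ⟨q, j, -, -, ha⟩ := hrun.step _ (hs a)
    exact ha.k_le_and_pool (hs (a + 1))
  obtain ⟨a, -, hno⟩ := (hfin.shift (i + 1)).exists_evaluated (fun a => (hstep a).1)
    (fun a => (hstep a).2) hs (i := 0) (Nat.zero_le _)
  -- Under the dummy incumbent `x^0` always has an open task, yet all its tasks eventually finish.
  obtain ⟨j, hj⟩ := (hrun.invariant hP _).startup (hs a) (hnone _ (by omega))
  exact hno j hj

theorem IsRun.inc_eq_of_optimal (hrun : H.IsRun P par u) (hP : P.Standing) {i i' : ℕ}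
    (hi : i ≤ i') (hr : (u i).inc = some r) (hS : H.x r ∈ P.solutionSet) :
    (u i').inc = some r := by
  induction i', hi using Nat.le_induction with
  | base => exact hr
  | succ i' hi ih =>
    rcases hrun.inc_succ hP i' with he | ⟨q, hq, -, hacc⟩
    · rw [he, ih]
    · exact absurd (hS.2 _ ((hrun.invariant hP i').feas q hq)) (not_le.2 (hacc.1 r ih))

/-- An incumbent that is not optimal is replaced. -/
theorem IsRun.exists_new_inc (hrun : H.IsRun P par u) (hP : P.Standing) (htol : par.εtol = 0)
    (hfin : TasksComplete u) {i : ℕ} (hS : H.point (u i).inc ∉ P.solutionSet) :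
    ∃ i' > i, ∃ r', (u i').inc = some r' ∧ (u i).inc ≠ some r' := by
  cases hinc : (u i).inc with
  | none =>
    obtain ⟨i', hi', hne⟩ := hrun.exists_inc_ne_none hP hfin i
    obtain ⟨r', hr'⟩ := Option.ne_none_iff_exists'.1 hne
    exact ⟨i', hi', r', hr', by simp⟩
  | some r =>
    rw [hinc] at hS
    by_contra! hall
    have hkeep : ∀ i' ≥ i, (u i').inc = some r := by
      intro i' hi'
      induction i', hi' using Nat.le_induction with
      | base => exact hinc
      | succ i' hi' ih =>
        rcases hrun.inc_succ hP i' with he | ⟨q, -, he, -⟩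
        · rw [he, ih]
        · rw [he, hall (i' + 1) (Nat.lt_succ_of_le hi') q he]
    refine hS ?_
    by_cases hs : ∀ i' ≥ i, (u i').stopped = false
    · exact (hrun.quietRun hP hfin hs hkeep).center_optimal htol hP
    · push Not at hs
      obtain ⟨i', hi', hst⟩ := hs
      obtain ⟨r', hr', hopt⟩ := (hrun.invariant hP i').optimal hP (by simpa using hst) htol
      obtain rfl : r = r' := Option.some.inj ((hkeep i' hi').symm.trans hr')
      exact hopt

end History

end ATR

/-! ### Convergence theorem -/

theorem mainTheorem4 {n m₁ n₂ m₂ N T : ℕ} (P : ATR.TwoStageLP n m₁ n₂ m₂ N T)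
    (hP : P.Standing) (par : ATR.Params) (htol : par.εtol = 0)
    (H : ATR.History n T) (s : ℕ → ATR.State n T)
    (hrun : H.IsRun P par s) (hfin : ATR.TasksComplete s) :
    -- (i) a non-optimal incumbent is replaced by a new one after finitely many events
    (∀ i, H.point (s i).inc ∉ P.solutionSet →
      ∃ i' > i, ∃ r', (s i').inc = some r' ∧ (s i).inc ≠ some r') ∧
    -- (ii) an optimal incumbent: termination with a certificate, or the gap decreases to zero
    (∀ i r, (s i).inc = some r → H.x r ∈ P.solutionSet →
      (∃ i', (s i').stopped = true ∧ (s i').inc = some r ∧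
        0 < H.Δ (s i').k ∧
        (∀ x, P.model (H.cuts (s i').k) x ≤ (P.Q x : EReal)) ∧
        ∀ x ∈ P.trustRegion (H.x r) (H.Δ (s i').k),
          (P.Q (H.x r) : EReal) ≤ P.model (H.cuts (s i').k) x) ∨
      ((∀ k, ∃ i', k ≤ (s i').k) ∧
        (∀ k ≥ (s i).k, H.parent k = some r) ∧
        AntitoneOn (fun k => P.Q (H.x r) - H.m k) (Set.Ici (s i).k) ∧
        Filter.Tendsto (fun k => P.Q (H.x r) - H.m k) Filter.atTop (nhds 0))) ∧
    -- termination occurs at an optimal incumbent only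
    (∀ i, (s i).stopped = true → ∃ r, (s i).inc = some r ∧ H.x r ∈ P.solutionSet) := by
  have hinv := hrun.invariant hP
  refine ⟨fun i hS => hrun.exists_new_inc hP htol hfin hS, fun i r hr hS => ?_,
    fun i hs => (hinv i).optimal hP hs htol⟩
  have hinc : ∀ i' ≥ i, (s i').inc = some r := fun i' hi' => hrun.inc_eq_of_optimal hP hi' hr hS
  by_cases hs : ∀ i' ≥ i, (s i').stopped = false
  · have hq := hrun.quietRun hP hfin hs hinc
    refine Or.inr ⟨fun k => ?_, fun k hk => hq.parent_eq hk, hq.gap_antitoneOn,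
      hq.gap_tendsto_zero htol hP⟩
    obtain ⟨a, ha⟩ := hq.k_unbounded k
    exact ⟨i + a, ha⟩
  · push Not at hs
    obtain ⟨i', hi', hst⟩ := hs
    have hst' : (s i').stopped = true := by simpa using hst
    exact Or.inl ⟨i', hst', hinc i' hi', (hinv i').certificate hst' htol (hinc i' hi')⟩
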